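/- Call a topological space \emph{orderable} if its topology is the order topology of some linear order on it, \emph{suborderable} if it is homeomorphic to a subspace of an orderable space, and \emph{locally ordered} if each of its points has a neighbourhood that is orderable in the subspace topology. Call a space \emph{loop-ordered} if it is homeomorphic to a quotient space obtained from a compact connected linearly ordered space with at least two points (carrying its order topology) by identifying the smallest and the greatest element. A \emph{locally ordered compactification} of a topological space $X$ is a compact Hausdorff locally ordered space $Y$ together with a homeomorphic embedding of $X$ onto a dense subspace of $Y$. \textbf{Theorem.} A topological space $X$ admits a locally ordered compactification if and only if $X$ is homeomorphic to a topological disjoint union $S \sqcup L_1 \sqcup \dots \sqcup L_n$ for some (possibly empty) suborderable space $S$, some integer $n \ge 0$ and some loop-ordered spaces $L_1, \dots, L_n$. -/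

import Mathlib

open Topology

universe u

/-- A topological space is orderable if its topology is the order topology of some linear order. -/
def IsOrderable (X : Type u) [TopologicalSpace X] : Prop :=
  ∃ _ : LinearOrder X, OrderTopology X

/-- A topological space is locally ordered if every point has a neighbourhood which is
orderable in the subspace topology. -/
def IsLocallyOrdered (X : Type u) [TopologicalSpace X] : Prop :=
  ∀ x : X, ∃ U ∈ 𝓝 x, IsOrderable U

/-- A topological space is suborderable (a generalised ordered space) if it is homeomorphic to a
subspace of an orderable space. -/
def IsSuborderable (X : Type u) [TopologicalSpace X] : Prop :=
  ∃ (Y : Type u) (_ : TopologicalSpace Y), IsOrderable Y ∧ ∃ f : X → Y, IsEmbedding f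

/-- The space obtained from a linearly ordered space by identifying the smallest and the greatest
element (if they exist); it carries the quotient topology. -/
abbrev EndpointQuotient (K : Type u) [LinearOrder K] : Type u :=
  Quot fun x y : K => IsBot x ∧ IsTop y

/-- A loop-ordered space is a space obtained from a compact connected linearly ordered space with
at least two points by identifying the smallest and the greatest element. -/
def IsLoopOrdered (X : Type u) [TopologicalSpace X] : Prop :=
  ∃ (K : Type u) (_ : LinearOrder K) (_ : TopologicalSpace K),
    OrderTopology K ∧ CompactSpace K ∧ ConnectedSpace K ∧ Nontrivial K ∧
      Nonempty (X ≃ₜ EndpointQuotient K)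

/-- A space admits a locally ordered compactification if it embeds densely in some compact
Hausdorff locally ordered space. -/
def HasLocallyOrderedCompactification (X : Type u) [TopologicalSpace X] : Prop :=
  ∃ (Y : Type u) (_ : TopologicalSpace Y),
    CompactSpace Y ∧ T2Space Y ∧ IsLocallyOrdered Y ∧ ∃ f : X → Y, IsDenseEmbedding f

/-! Let `Y` be compact Hausdorff and locally ordered. The core is that every point of `Y` has a
clopen neighbourhood which is ordered or a loop (`IsLocallyOrdered.exists_isClopen`). An arc is a
neighbourhood of each of its points other than its ends (`IsArc.mem_nhds`), so another arc can leave
it only through an end. Cover a component by finitely many arcs and lengthen one of them as far as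
possible: either it exhausts the component or it closes up to a loop
(`IsLocallyOrdered.isArc_or_isLoop`). A loop has no ends, hence is open. A nondegenerate arc
component grows at both ends to an ordered neighbourhood of itself (`IsArc.exists_orderedOn`),
inside which a clopen set fits, because components of a compact Hausdorff space are intersections of
clopen sets.

Finitely many such pieces, made disjoint, cover `Y`. The trace of `X` on an ordered piece is
suborderable. Its trace on a loop is the whole loop or misses a point, and a loop cut at a point is
suborderable (`isSuborderableSumLoops_preimage`). Since clopen sums of two suborderable spaces are
suborderable, all traces other than whole loops merge into `S`.

Conversely, `S` embeds in the Dedekind completion of an ordered space, where its closure is compact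
and ordered; loop-ordered spaces are themselves compact, Hausdorff and locally ordered.

Orders are linear orders on all of `Y` of which only the restriction to a given subset matters.
Different subsets carry unrelated orders, and `OrderedOn.glue` merges two of them. -/

/-! ### Closed ordered subsets and arcs -/

section OrderedSets

open Set

variable {Y Z : Type u} [TopologicalSpace Y] [TopologicalSpace Z]

/-- The order of `Y` has closed rays in the subset `A`, both in the topology of `Y`. For compact
`A` this says that the subspace topology of `A` is the order topology. -/
structure OrderedOn [LinearOrder Y] (A : Set Y) : Prop where
  isClosed_Iic : ∀ x ∈ A, IsClosed (A ∩ Iic x)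
  isClosed_Ici : ∀ x ∈ A, IsClosed (A ∩ Ici x)

/-- The opposite of a linear order, as an order on the same type. -/
abbrev reverseOrder (L : LinearOrder Y) : LinearOrder Y :=
  @OrderDual.instLinearOrder Y L

/-- A connected set which is ordered with closed rays and has endpoints `a` and `b`. -/
def IsArc (A : Set Y) (a b : Y) : Prop :=
  ∃ _ : LinearOrder Y, OrderedOn A ∧ IsPreconnected A ∧ IsLeast A a ∧ IsGreatest A b

/-- The identity is continuous from a compact to a Hausdorff topology, hence closed. -/
theorem topology_eq_of_le {α : Type u} {t t' : TopologicalSpace α} (hle : t ≤ t')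
    (hK : @CompactSpace α t) (hT2 : @T2Space α t') : t = t' := by
  refine le_antisymm hle fun s hs => ?_
  have := @Continuous.isClosedMap α α t t' hK hT2 id (continuous_id_iff_le.2 hle) sᶜ
    ((@isClosed_compl_iff α t s).2 hs)
  rw [image_id] at this
  exact (@isClosed_compl_iff α t' s).1 this

namespace OrderedOn

theorem reverse {L : LinearOrder Y} {A : Set Y} (h : OrderedOn A) :
    @OrderedOn Y _ (reverseOrder L) A :=
  @OrderedOn.mk Y _ (reverseOrder L) A h.isClosed_Ici h.isClosed_Iic

section

variable [LinearOrder Y] {A B D : Set Y} {x y z : Y}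

theorem isClosed (h : OrderedOn A) : IsClosed A := by
  rcases A.eq_empty_or_nonempty with rfl | ⟨x, hx⟩
  · exact isClosed_empty
  · have : A = A ∩ Iic x ∪ A ∩ Ici x := by
      ext y
      have := le_total y x
      simp only [mem_union, mem_inter_iff, mem_Iic, mem_Ici]
      tauto
    rw [this]
    exact (h.isClosed_Iic x hx).union (h.isClosed_Ici x hx)

theorem mono (h : OrderedOn A) (hBA : B ⊆ A) (hB : IsClosed B) : OrderedOn B where
  isClosed_Iic x hx := by
    have : B ∩ Iic x = B ∩ (A ∩ Iic x) := by
      rw [← inter_assoc, inter_eq_left.2 hBA]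
    rw [this]
    exact hB.inter (h.isClosed_Iic x (hBA hx))
  isClosed_Ici x hx := by
    have : B ∩ Ici x = B ∩ (A ∩ Ici x) := by
      rw [← inter_assoc, inter_eq_left.2 hBA]
    rw [this]
    exact hB.inter (h.isClosed_Ici x (hBA hx))

theorem isClosed_Icc (h : OrderedOn A) (hx : x ∈ A) (hy : y ∈ A) : IsClosed (A ∩ Icc x y) := by
  have : A ∩ Icc x y = (A ∩ Ici x) ∩ (A ∩ Iic y) := by
    ext z
    simp only [mem_inter_iff, mem_Icc, mem_Ici, mem_Iic]
    tauto
  rw [this]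
  exact (h.isClosed_Ici x hx).inter (h.isClosed_Iic y hy)

theorem Ioi_mem_nhdsWithin (h : OrderedOn A) (hx : x ∈ A) (hy : x < y) : Ioi x ∈ 𝓝[A] y := by
  have : (A ∩ Iic x)ᶜ ∈ 𝓝 y :=
    (h.isClosed_Iic x hx).isOpen_compl.mem_nhds (fun hh => not_le.2 hy hh.2)
  filter_upwards [mem_nhdsWithin_of_mem_nhds this, self_mem_nhdsWithin] with z hz hzA
  exact not_le.1 fun hle => hz ⟨hzA, hle⟩

theorem Iio_mem_nhdsWithin (h : OrderedOn A) (hx : x ∈ A) (hy : y < x) : Iio x ∈ 𝓝[A] y := by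
  have : (A ∩ Ici x)ᶜ ∈ 𝓝 y :=
    (h.isClosed_Ici x hx).isOpen_compl.mem_nhds (fun hh => not_le.2 hy hh.2)
  filter_upwards [mem_nhdsWithin_of_mem_nhds this, self_mem_nhdsWithin] with z hz hzA
  exact not_le.1 fun hle => hz ⟨hzA, hle⟩

/-- A point `z` missing from `D` would separate it by the closed rays at `z`. -/
theorem convex (h : OrderedOn A) (hD : IsPreconnected D) (hDA : D ⊆ A) (hx : x ∈ D) (hy : y ∈ D)
    (hz : z ∈ A) (hxz : x ≤ z) (hzy : z ≤ y) : z ∈ D := by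
  by_contra hzD
  obtain ⟨w, hwD, hw⟩ := isPreconnected_closed_iff.1 hD _ _ (h.isClosed_Iic z hz)
    (h.isClosed_Ici z hz)
    (fun w hw => (le_total w z).imp (fun h => ⟨hDA hw, h⟩) fun h => ⟨hDA hw, h⟩)
    ⟨x, hx, hDA hx, hxz⟩ ⟨y, hy, hDA hy, hzy⟩
  exact hzD (le_antisymm hw.1.2 hw.2.2 ▸ hwD)

theorem exists_between (h : OrderedOn A) (hA : IsPreconnected A) (hx : x ∈ A) (hy : y ∈ A)
    (hxy : x < y) : ∃ z ∈ A, x < z ∧ z < y := by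
  by_contra! hno
  obtain ⟨w, -, hw⟩ := isPreconnected_closed_iff.1 hA _ _ (h.isClosed_Iic x hx)
    (h.isClosed_Ici y hy)
    (fun w hw => (le_or_gt w x).imp (fun h => ⟨hw, h⟩) fun h => ⟨hw, hno w hw h⟩)
    ⟨x, hx, hx, le_rfl⟩ ⟨y, hy, hy, le_rfl⟩
  exact not_lt.2 (hw.2.2.trans hw.1.2) hxy

/-- Closed rays make the subspace topology finer than the order topology; the former is compact and
the latter Hausdorff, so they agree. -/
theorem orderTopology [T2Space Y] (h : OrderedOn A) (hA : IsCompact A) : OrderTopology A := by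
  have hK := isCompact_iff_compactSpace.1 hA
  have hle : (instTopologicalSpaceSubtype : TopologicalSpace A) ≤ Preorder.topology A := by
    refine le_generateFrom ?_
    rintro s ⟨a, rfl | rfl⟩
    · have : IsClosed ((Subtype.val : A → Y) ⁻¹' (A ∩ Iic a.1)) :=
        (h.isClosed_Iic a a.2).preimage continuous_subtype_val
      convert this.isOpen_compl using 1
      ext z
      simp
    · have : IsClosed ((Subtype.val : A → Y) ⁻¹' (A ∩ Ici a.1)) :=
        (h.isClosed_Ici a a.2).preimage continuous_subtype_val
      convert this.isOpen_compl using 1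
      ext z
      simp
  have hT2 : @T2Space A (Preorder.topology A) :=
    @OrderClosedTopology.to_t2Space A (Preorder.topology A) _
      (@OrderTopology.to_orderClosedTopology A (Preorder.topology A) _
        (@OrderTopology.mk A (Preorder.topology A) _ rfl))
  exact ⟨topology_eq_of_le hle hK hT2⟩

theorem isOrderable [T2Space Y] (h : OrderedOn A) (hA : IsCompact A) : IsOrderable A :=
  ⟨inferInstance, h.orderTopology hA⟩

theorem exists_isLeast [CompactSpace Y] [T2Space Y] (h : OrderedOn A) (hBA : B ⊆ A)
    (hB : IsClosed B) (hne : B.Nonempty) : ∃ m, IsLeast B m := by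
  have := (h.mono hBA hB).orderTopology hB.isCompact
  have := isCompact_iff_compactSpace.1 hB.isCompact
  have := hne.to_subtype
  obtain ⟨m, -, hm⟩ := (isCompact_univ (X := B)).exists_isLeast univ_nonempty
  exact ⟨m, m.2, fun x hx => hm (mem_univ ⟨x, hx⟩)⟩

theorem exists_isGreatest [CompactSpace Y] [T2Space Y] (h : OrderedOn A) (hBA : B ⊆ A)
    (hB : IsClosed B) (hne : B.Nonempty) : ∃ m, IsGreatest B m :=
  @OrderedOn.exists_isLeast Y _ (reverseOrder inferInstance) A B _ _ h.reverse hBA hB hne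

theorem isPreconnected_Icc [CompactSpace Y] [T2Space Y] (h : OrderedOn A) (hA : IsPreconnected A)
    (hx : x ∈ A) (hy : y ∈ A) : IsPreconnected (A ∩ Icc x y) := by
  rcases lt_or_ge y x with hxy | hxy
  · rw [Icc_eq_empty (not_le.2 hxy), inter_empty]
    exact isPreconnected_empty
  · have := h.orderTopology h.isClosed.isCompact
    have := isPreconnected_iff_preconnectedSpace.1 hA
    have hle : (⟨x, hx⟩ : A) ≤ ⟨y, hy⟩ := hxy
    -- The interval is the image of `A` under the retraction `projIcc`.
    have hr := (isPreconnected_univ (α := A)).image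
      (fun z => ((projIcc _ _ hle z : Icc (⟨x, hx⟩ : A) ⟨y, hy⟩) : A).1)
      (continuous_subtype_val.comp
        (continuous_subtype_val.comp continuous_projIcc)).continuousOn
    convert hr using 1
    ext z
    constructor
    · rintro ⟨hzA, hz⟩
      exact ⟨⟨z, hzA⟩, trivial, by
        change ((projIcc _ _ hle ⟨z, hzA⟩ : Icc (⟨x, hx⟩ : A) ⟨y, hy⟩) : A).1 = z
        rw [projIcc_of_mem hle (x := (⟨z, hzA⟩ : A)) ⟨hz.1, hz.2⟩]⟩
    · rintro ⟨w, -, rfl⟩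
      set v := projIcc _ _ hle w
      exact ⟨v.1.2, v.2.1, v.2.2⟩

theorem isArc_Icc [CompactSpace Y] [T2Space Y] (h : OrderedOn A) (hA : IsPreconnected A)
    (hx : x ∈ A) (hy : y ∈ A) (hxy : x ≤ y) : IsArc (A ∩ Icc x y) x y :=
  ⟨inferInstance, h.mono inter_subset_left (h.isClosed_Icc hx hy), h.isPreconnected_Icc hA hx hy,
    ⟨⟨hx, le_rfl, hxy⟩, fun _ hz => hz.2.1⟩, ⟨hy, hxy, le_rfl⟩, fun _ hz => hz.2.2⟩

/-- Separate the interval into closed parts `F`, containing `x`, and `G`. The jump runs to the least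
point `v` of `G` from the greatest point `u` of `F` below it. -/
theorem exists_jump [CompactSpace Y] [T2Space Y] (h : OrderedOn A) (hx : x ∈ A) (hy : y ∈ A)
    (hn : ¬ IsPreconnected (A ∩ Icc x y)) :
    ∃ u ∈ A, ∃ v ∈ A, x ≤ u ∧ u < v ∧ v ≤ y ∧ ∀ w ∈ A, w ≤ u ∨ v ≤ w := by
  have key : ∀ F G : Set Y, IsClosed F → IsClosed G → A ∩ Icc x y ⊆ F ∪ G →
      ((A ∩ Icc x y) ∩ F).Nonempty → ((A ∩ Icc x y) ∩ G).Nonempty →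
      ¬ ((A ∩ Icc x y) ∩ (F ∩ G)).Nonempty → x ∈ F →
      ∃ u ∈ A, ∃ v ∈ A, x ≤ u ∧ u < v ∧ v ≤ y ∧ ∀ w ∈ A, w ≤ u ∨ v ≤ w := by
    intro F G hF hG hcov _ hGne hdis hxF
    have hI := h.isClosed_Icc hx hy
    obtain ⟨v, hv, hvl⟩ := h.exists_isLeast (inter_subset_left.trans inter_subset_left)
      (hI.inter hG) hGne
    have hFc : IsClosed ((A ∩ Icc x y) ∩ F ∩ (A ∩ Iic v)) :=
      (hI.inter hF).inter (h.isClosed_Iic v hv.1.1)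
    obtain ⟨u, hu, hul⟩ := h.exists_isGreatest
      (inter_subset_left.trans (inter_subset_left.trans inter_subset_left)) hFc
      ⟨x, ⟨⟨hx, le_rfl, hv.1.2.1.trans hv.1.2.2⟩, hxF⟩, hx, hv.1.2.1⟩
    have huv : u < v := lt_of_le_of_ne hu.2.2 fun e => hdis ⟨u, hu.1.1, hu.1.2, e ▸ hv.2⟩
    refine ⟨u, hu.1.1.1, v, hv.1.1, hu.1.1.2.1, huv, hv.1.2.2, fun w hw => ?_⟩
    by_contra! hcon
    have hwI : w ∈ A ∩ Icc x y :=
      ⟨hw, hu.1.1.2.1.trans hcon.1.le, hcon.2.le.trans hv.1.2.2⟩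
    rcases hcov hwI with hwF | hwG
    · exact not_lt.2 (hul ⟨⟨hwI, hwF⟩, hw, hcon.2.le⟩) hcon.1
    · exact not_lt.2 (hvl ⟨hwI, hwG⟩) hcon.2
  rw [isPreconnected_closed_iff] at hn
  push Not at hn
  obtain ⟨F, G, hF, hG, hcov, hFne, hGne, hdis⟩ := hn
  have hxI : x ∈ A ∩ Icc x y := by
    obtain ⟨w, hw, -⟩ := hFne
    exact ⟨hx, le_rfl, hw.2.1.trans hw.2.2⟩
  rcases hcov hxI with hxF | hxG
  · exact key F G hF hG hcov hFne hGne (by rw [hdis]; exact not_nonempty_empty) hxF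
  · exact key G F hG hF (by rwa [union_comm]) hGne hFne
      (by rw [inter_comm G, hdis]; exact not_nonempty_empty) hxG

end

end OrderedOn

/-- A relation which is a linear order on a subset extends to a linear order on the whole type. -/
theorem exists_linearOrder_of_rel {Y : Type u} {A : Set Y} {r : Y → Y → Prop}
    (hrefl : ∀ x ∈ A, r x x)
    (htrans : ∀ x ∈ A, ∀ y ∈ A, ∀ z ∈ A, r x y → r y z → r x z)
    (hanti : ∀ x ∈ A, ∀ y ∈ A, r x y → r y x → x = y)
    (htotal : ∀ x ∈ A, ∀ y ∈ A, r x y ∨ r y x) :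
    ∃ L : LinearOrder Y, ∀ x ∈ A, ∀ y ∈ A, L.le x y ↔ r x y := by
  let s : Y → Y → Prop := fun x y => x = y ∨ (x ∈ A ∧ y ∈ A ∧ r x y)
  have hs : IsPartialOrder Y s :=
    { refl := fun x => Or.inl rfl
      trans := by
        rintro x y z (rfl | ⟨h1, h2, h3⟩) (rfl | ⟨h4, h5, h6⟩)
        · exact Or.inl rfl
        · exact Or.inr ⟨h4, h5, h6⟩
        · exact Or.inr ⟨h1, h2, h3⟩
        · exact Or.inr ⟨h1, h5, htrans x h1 y h2 z h5 h3 h6⟩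
      antisymm := by
        rintro x y (rfl | ⟨h1, h2, h3⟩) (h | ⟨h4, h5, h6⟩)
        · rfl
        · rfl
        · exact h.symm
        · exact hanti x h1 y h2 h3 h6 }
  obtain ⟨t, ht, hst⟩ := extend_partialOrder s
  classical
  let L : LinearOrder Y :=
    { le := t
      le_refl := ht.refl
      le_trans := ht.trans
      le_antisymm := fun a b => ht.antisymm a b
      le_total := ht.total
      toDecidableLE := Classical.decRel _ }
  refine ⟨L, fun x hx y hy => ⟨fun h => ?_, fun h => hst x y (Or.inr ⟨hx, hy, h⟩)⟩⟩
  rcases htotal x hx y hy with h' | h'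
  · exact h'
  · have : x = y := ht.antisymm x y h (hst y x (Or.inr ⟨hy, hx, h'⟩))
    exact this ▸ hrefl x hx

/-- The order is carried over along the injection; rays are compact, so their images are closed. -/
theorem OrderedOn.image [CompactSpace Y] [T2Space Z] [LinearOrder Y] {A : Set Y} (h : OrderedOn A)
    {g : Y → Z} (hg : ContinuousOn g A) (hinj : InjOn g A) :
    ∃ _ : LinearOrder Z, OrderedOn (g '' A) ∧ ∀ x ∈ A, ∀ y ∈ A, g x ≤ g y ↔ x ≤ y := by
  obtain ⟨L, hL⟩ := exists_linearOrder_of_rel (A := g '' A)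
    (r := fun u v => ∃ x ∈ A, ∃ y ∈ A, g x = u ∧ g y = v ∧ x ≤ y)
    (by rintro _ ⟨x, hx, rfl⟩; exact ⟨x, hx, x, hx, rfl, rfl, le_rfl⟩)
    (by
      rintro _ - _ - _ - ⟨x, hx, y, hy, rfl, rfl, hxy⟩ ⟨y', hy', z, hz, e, rfl, hyz⟩
      exact ⟨x, hx, z, hz, rfl, rfl, hxy.trans (hinj hy' hy e ▸ hyz)⟩)
    (by
      rintro _ - _ - ⟨x, hx, y, hy, rfl, rfl, hxy⟩ ⟨y', hy', x', hx', e, e', hyz⟩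
      rw [hinj hy' hy e, hinj hx' hx e'] at hyz
      rw [le_antisymm hxy hyz])
    (by
      rintro _ ⟨x, hx, rfl⟩ _ ⟨y, hy, rfl⟩
      exact (le_total x y).imp (fun h => ⟨x, hx, y, hy, rfl, rfl, h⟩)
        fun h => ⟨y, hy, x, hx, rfl, rfl, h⟩)
  have hle : ∀ x ∈ A, ∀ y ∈ A, L.le (g x) (g y) ↔ x ≤ y := fun x hx y hy => by
    rw [hL _ (mem_image_of_mem g hx) _ (mem_image_of_mem g hy)]
    constructor
    · rintro ⟨x', hx', y', hy', e, e', hle⟩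
      rwa [hinj hx' hx e, hinj hy' hy e'] at hle
    · exact fun hle => ⟨x, hx, y, hy, rfl, rfl, hle⟩
  refine ⟨L, ⟨?_, ?_⟩, hle⟩
  · rintro _ ⟨x, hx, rfl⟩
    have : g '' A ∩ Iic (g x) = g '' (A ∩ Iic x) := by
      ext z
      constructor
      · rintro ⟨⟨y, hy, rfl⟩, hz⟩
        exact ⟨y, ⟨hy, (hle y hy x hx).1 hz⟩, rfl⟩
      · rintro ⟨y, ⟨hy, hyx⟩, rfl⟩
        exact ⟨⟨y, hy, rfl⟩, (hle y hy x hx).2 hyx⟩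
    rw [this]
    exact ((h.isClosed_Iic x hx).isCompact.image_of_continuousOn
      (hg.mono inter_subset_left)).isClosed
  · rintro _ ⟨x, hx, rfl⟩
    have : g '' A ∩ Ici (g x) = g '' (A ∩ Ici x) := by
      ext z
      constructor
      · rintro ⟨⟨y, hy, rfl⟩, hz⟩
        exact ⟨y, ⟨hy, (hle x hx y hy).1 hz⟩, rfl⟩
      · rintro ⟨y, ⟨hy, hyx⟩, rfl⟩
        exact ⟨⟨y, hy, rfl⟩, (hle x hx y hy).2 hyx⟩
    rw [this]
    exact ((h.isClosed_Ici x hx).isCompact.image_of_continuousOn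
      (hg.mono inter_subset_left)).isClosed

/-- Two ordered sets, each carrying its own order, which are disjoint or meet in the greatest
element of the first and the least element of the second, form one ordered set. -/
theorem OrderedOn.glue {L₁ L₂ : LinearOrder Y} {A B : Set Y}
    (hA : @OrderedOn Y _ L₁ A) (hB : @OrderedOn Y _ L₂ B)
    (hAB : ∀ p ∈ A, p ∈ B → (∀ x ∈ A, L₁.le x p) ∧ ∀ x ∈ B, L₂.le p x) :
    ∃ _ : LinearOrder Y, OrderedOn (A ∪ B) ∧ (∀ x ∈ A, ∀ y ∈ A, x ≤ y ↔ L₁.le x y) ∧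
      (∀ x ∈ B, ∀ y ∈ B, x ≤ y ↔ L₂.le x y) ∧ ∀ x ∈ A, ∀ y ∈ B, x ≤ y := by
  have r1 := L₁.le_refl
  have t1 := L₁.le_trans
  have a1 := L₁.le_antisymm
  have o1 := L₁.le_total
  have r2 := L₂.le_refl
  have t2 := L₂.le_trans
  have a2 := L₂.le_antisymm
  have o2 := L₂.le_total
  generalize hle1 : L₁.le = le1 at *
  generalize hle2 : L₂.le = le2 at *
  -- Both orders, together with everything in `A` before everything in `B`. At a common point `hAB`
  -- reconciles the three clauses.
  let r : Y → Y → Prop := fun x y =>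
    (x ∈ A ∧ y ∈ A ∧ le1 x y) ∨ (x ∈ B ∧ y ∈ B ∧ le2 x y) ∨ (x ∈ A ∧ y ∈ B)
  obtain ⟨L, hL⟩ := exists_linearOrder_of_rel (A := A ∪ B) (r := r)
    (by
      rintro x (hx | hx)
      · exact Or.inl ⟨hx, hx, r1 x⟩
      · exact Or.inr (Or.inl ⟨hx, hx, r2 x⟩))
    (by
      rintro x - y - z - (⟨hx, hy, h⟩ | ⟨hx, hy, h⟩ | ⟨hx, hy⟩)
        (⟨hy', hz, h'⟩ | ⟨hy', hz, h'⟩ | ⟨hy', hz⟩)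
      · exact Or.inl ⟨hx, hz, t1 _ _ _ h h'⟩
      · exact Or.inr (Or.inr ⟨hx, hz⟩)
      · exact Or.inr (Or.inr ⟨hx, hz⟩)
      · have e : y = x := a2 _ _ ((hAB y hy' hy).2 x hx) h
        subst e
        exact Or.inl ⟨hy', hz, h'⟩
      · exact Or.inr (Or.inl ⟨hx, hz, t2 _ _ _ h h'⟩)
      · exact Or.inr (Or.inl ⟨hx, hz, t2 _ _ _ h ((hAB y hy' hy).2 z hz)⟩)
      · have e : y = z := a1 _ _ h' ((hAB y hy' hy).1 z hz)
        subst e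
        exact Or.inr (Or.inr ⟨hx, hy⟩)
      · exact Or.inr (Or.inr ⟨hx, hz⟩)
      · exact Or.inr (Or.inr ⟨hx, hz⟩))
    (by
      rintro x - y - (⟨hx, hy, h⟩ | ⟨hx, hy, h⟩ | ⟨hx, hy⟩)
        (⟨hy', hx', h'⟩ | ⟨hy', hx', h'⟩ | ⟨hy', hx'⟩)
      · exact a1 _ _ h h'
      · exact a1 _ _ h ((hAB x hx hx').1 y hy)
      · exact a1 _ _ h ((hAB x hx hx').1 y hy)
      · exact a2 _ _ h ((hAB y hy' hy).2 x hx)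
      · exact a2 _ _ h h'
      · exact a2 _ _ h ((hAB y hy' hy).2 x hx)
      · exact a1 _ _ ((hAB y hy' hy).1 x hx) h'
      · exact a2 _ _ ((hAB x hx hx').2 y hy) h'
      · exact a1 _ _ ((hAB y hy' hy).1 x hx) ((hAB x hx hx').1 y hy'))
    (by
      rintro x (hx | hx) y (hy | hy)
      · exact (o1 x y).imp (fun h => Or.inl ⟨hx, hy, h⟩) fun h => Or.inl ⟨hy, hx, h⟩
      · exact Or.inl (Or.inr (Or.inr ⟨hx, hy⟩))
      · exact Or.inr (Or.inr (Or.inr ⟨hy, hx⟩))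
      · exact (o2 x y).imp (fun h => Or.inr (Or.inl ⟨hx, hy, h⟩))
          fun h => Or.inr (Or.inl ⟨hy, hx, h⟩))
  have hLA : ∀ x ∈ A, ∀ y ∈ A, L.le x y ↔ le1 x y := by
    intro x hx y hy
    rw [hL x (Or.inl hx) y (Or.inl hy)]
    constructor
    · rintro (h | h | h)
      · exact h.2.2
      · have e : y = x := a2 _ _ ((hAB y hy h.2.1).2 x h.1) h.2.2
        exact e ▸ r1 y
      · exact (hAB y hy h.2).1 x hx
    · exact fun h => Or.inl ⟨hx, hy, h⟩
  have hLB : ∀ x ∈ B, ∀ y ∈ B, L.le x y ↔ le2 x y := by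
    intro x hx y hy
    rw [hL x (Or.inr hx) y (Or.inr hy)]
    constructor
    · rintro (h | h | h)
      · have e : x = y := a1 _ _ h.2.2 ((hAB x h.1 hx).1 y h.2.1)
        exact e ▸ r2 x
      · exact h.2.2
      · exact (hAB x h.1 hx).2 y hy
    · exact fun h => Or.inr (Or.inl ⟨hx, hy, h⟩)
  have hLAB : ∀ x ∈ A, ∀ y ∈ B, L.le x y := fun x hx y hy =>
    (hL x (Or.inl hx) y (Or.inr hy)).2 (Or.inr (Or.inr ⟨hx, hy⟩))
  have hAc : IsClosed A := @OrderedOn.isClosed Y _ L₁ A hA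
  have hBc : IsClosed B := @OrderedOn.isClosed Y _ L₂ B hB
  subst hle1 hle2
  refine ⟨L, ⟨?_, ?_⟩, hLA, hLB, hLAB⟩
  · rintro x (hx | hx)
    · by_cases hxB : x ∈ B
      · have : (A ∪ B) ∩ Iic x = A := by
          ext y
          constructor
          · rintro ⟨hy | hy, hyx⟩
            · exact hy
            · rwa [a2 _ _ ((hLB y hy x hxB).1 hyx) ((hAB x hx hxB).2 y hy)]
          · exact fun hy => ⟨Or.inl hy, hLAB y hy x hxB⟩
        rwa [this]
      · have : (A ∪ B) ∩ Iic x = A ∩ {y | L₁.le y x} := by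
          ext y
          constructor
          · rintro ⟨hy | hy, hyx⟩
            · exact ⟨hy, (hLA y hy x hx).1 hyx⟩
            · exact absurd (L.le_antisymm _ _ hyx (hLAB x hx y hy) ▸ hy) hxB
          · exact fun hy => ⟨Or.inl hy.1, (hLA y hy.1 x hx).2 hy.2⟩
        rw [this]
        exact @OrderedOn.isClosed_Iic Y _ L₁ A hA x hx
    · have : (A ∪ B) ∩ Iic x = A ∪ B ∩ {y | L₂.le y x} := by
        ext y
        constructor
        · rintro ⟨hy | hy, hyx⟩
          · exact Or.inl hy
          · exact Or.inr ⟨hy, (hLB y hy x hx).1 hyx⟩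
        · rintro (hy | hy)
          · exact ⟨Or.inl hy, hLAB y hy x hx⟩
          · exact ⟨Or.inr hy.1, (hLB y hy.1 x hx).2 hy.2⟩
      rw [this]
      exact hAc.union (@OrderedOn.isClosed_Iic Y _ L₂ B hB x hx)
  · rintro x (hx | hx)
    · have : (A ∪ B) ∩ Ici x = A ∩ {y | L₁.le x y} ∪ B := by
        ext y
        constructor
        · rintro ⟨hy | hy, hyx⟩
          · exact Or.inl ⟨hy, (hLA x hx y hy).1 hyx⟩
          · exact Or.inr hy
        · rintro (hy | hy)
          · exact ⟨Or.inl hy.1, (hLA x hx y hy.1).2 hy.2⟩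
          · exact ⟨Or.inr hy, hLAB x hx y hy⟩
      rw [this]
      exact (@OrderedOn.isClosed_Ici Y _ L₁ A hA x hx).union hBc
    · by_cases hxA : x ∈ A
      · have : (A ∪ B) ∩ Ici x = B := by
          ext y
          constructor
          · rintro ⟨hy | hy, hyx⟩
            · rwa [a1 _ _ ((hAB x hxA hx).1 y hy) ((hLA x hxA y hy).1 hyx)]
            · exact hy
          · exact fun hy => ⟨Or.inr hy, hLAB x hxA y hy⟩
        rwa [this]
      · have : (A ∪ B) ∩ Ici x = B ∩ {y | L₂.le x y} := by
          ext y
          constructor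
          · rintro ⟨hy | hy, hyx⟩
            · exact absurd (L.le_antisymm _ _ (hLAB y hy x hx) hyx ▸ hy) hxA
            · exact ⟨hy, (hLB x hx y hy).1 hyx⟩
          · exact fun hy => ⟨Or.inr hy.1, (hLB x hx y hy.1).2 hy.2⟩
        rw [this]
        exact @OrderedOn.isClosed_Ici Y _ L₂ B hB x hx

namespace IsArc

variable {A B : Set Y} {a b c x y : Y}

theorem symm (h : IsArc A a b) : IsArc A b a := by
  obtain ⟨L, hA, hc, hl, hg⟩ := h
  exact ⟨reverseOrder L, hA.reverse, hc, hg, hl⟩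

theorem isClosed (h : IsArc A a b) : IsClosed A := by
  obtain ⟨L, hA, -⟩ := h
  exact hA.isClosed

theorem left_mem (h : IsArc A a b) : a ∈ A := by
  obtain ⟨L, -, -, hA, -⟩ := h
  exact hA.1

theorem right_mem (h : IsArc A a b) : b ∈ A := h.symm.left_mem

theorem glue (hA : IsArc A a b) (hB : IsArc B b c) (hAB : A ∩ B ⊆ {b}) : IsArc (A ∪ B) a c := by
  obtain ⟨L₁, hA, hAc, hAl, hAg⟩ := hA
  obtain ⟨L₂, hB, hBc, hBl, hBg⟩ := hB
  obtain ⟨L, hO, h1, h2, h3⟩ := hA.glue hB fun p hpA hpB => by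
    obtain rfl : p = b := hAB ⟨hpA, hpB⟩
    exact ⟨fun x hx => hAg.2 hx, fun x hx => hBl.2 hx⟩
  refine ⟨L, hO, hAc.union b hAg.1 hBl.1 hBc, ⟨Or.inl hAl.1, ?_⟩, Or.inr hBg.1, ?_⟩
  · rintro x (hx | hx)
    · exact (h1 a hAl.1 x hx).2 (hAl.2 hx)
    · exact h3 a hAl.1 x hx
  · rintro x (hx | hx)
    · exact h3 x hx c hBg.1
    · exact (h2 x hx c hBg.1).2 (hBg.2 hx)

theorem image [CompactSpace Y] [T2Space Z] (h : IsArc A a b) {g : Y → Z} (hg : ContinuousOn g A)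
    (hinj : InjOn g A) : IsArc (g '' A) (g a) (g b) := by
  obtain ⟨L, hA, hc, hl, hgr⟩ := h
  obtain ⟨L', hO, hle⟩ := hA.image hg hinj
  refine ⟨L', hO, hc.image g hg, ⟨mem_image_of_mem g hl.1, ?_⟩, mem_image_of_mem g hgr.1, ?_⟩
  · rintro _ ⟨x, hx, rfl⟩
    exact (hle a hl.1 x hx).2 (hl.2 hx)
  · rintro _ ⟨x, hx, rfl⟩
    exact (hle x hx b hgr.1).2 (hgr.2 hx)

/-- An arc is split by each of its points into two arcs which meet in this point only. -/
theorem split [CompactSpace Y] [T2Space Y] (h : IsArc A a b) (hx : x ∈ A) :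
    ∃ B C : Set Y, A = B ∪ C ∧ B ∩ C = {x} ∧ IsArc B a x ∧ IsArc C x b := by
  obtain ⟨_, hA, hc, hl, hg⟩ := h
  refine ⟨A ∩ Icc a x, A ∩ Icc x b, ?_, ?_, hA.isArc_Icc hc hl.1 hx (hl.2 hx),
    hA.isArc_Icc hc hx hg.1 (hg.2 hx)⟩
  · ext z
    constructor
    · exact fun hz => (le_total z x).imp (fun h => ⟨hz, hl.2 hz, h⟩) fun h => ⟨hz, h, hg.2 hz⟩
    · rintro (hz | hz) <;> exact hz.1
  · ext z
    constructor
    · exact fun hz => le_antisymm hz.1.2.2 hz.2.2.1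
    · rintro rfl
      exact ⟨⟨hx, hl.2 hx, le_rfl⟩, hx, le_rfl, hg.2 hx⟩

end IsArc

end OrderedSets

/-! ### Local structure: arcs as neighbourhoods -/

section LocallyOrderedSpaces

open Set

variable {Y : Type u} [TopologicalSpace Y]

/-- A closed neighbourhood inside an orderable `U` inherits its order, and rays closed relative to
`U` become closed in `Y` on it. -/
theorem IsLocallyOrdered.exists_orderedOn [T2Space Y] [CompactSpace Y] (hY : IsLocallyOrdered Y)
    {x : Y} {W : Set Y} (hW : W ∈ 𝓝 x) :
    ∃ N ∈ 𝓝 x, N ⊆ W ∧ ∃ _ : LinearOrder Y, OrderedOn N := by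
  obtain ⟨U, hU, LU, hLU⟩ := hY x
  obtain ⟨N, hN, hNc, hNU⟩ := exists_mem_nhds_isClosed_subset (Filter.inter_mem hU hW)
  have hNU' : N ⊆ U := hNU.trans inter_subset_left
  have hIic : ∀ y : U, ∃ T : Set Y, IsClosed T ∧ ∀ z : U, z.1 ∈ T ↔ z ≤ y := fun y => by
    obtain ⟨T, hT, hTU⟩ := isClosed_induced_iff.1 (isClosed_Iic (a := y))
    exact ⟨T, hT, fun z => Set.ext_iff.1 hTU z⟩
  have hIci : ∀ y : U, ∃ T : Set Y, IsClosed T ∧ ∀ z : U, z.1 ∈ T ↔ y ≤ z := fun y => by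
    obtain ⟨T, hT, hTU⟩ := isClosed_induced_iff.1 (isClosed_Ici (a := y))
    exact ⟨T, hT, fun z => Set.ext_iff.1 hTU z⟩
  obtain ⟨L, hL⟩ := exists_linearOrder_of_rel (A := N)
    (r := fun x y => ∃ (hx : x ∈ U) (hy : y ∈ U), (⟨x, hx⟩ : U) ≤ ⟨y, hy⟩)
    (fun x hx => ⟨hNU' hx, hNU' hx, le_rfl⟩)
    (by
      rintro x - y - z - ⟨hx, hy, h⟩ ⟨hy', hz, h'⟩
      exact ⟨hx, hz, h.trans h'⟩)
    (by
      rintro x - y - ⟨hx, hy, h⟩ ⟨hy', hz, h'⟩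
      exact congrArg Subtype.val (le_antisymm h h'))
    (fun x hx y hy => (le_total (⟨x, hNU' hx⟩ : U) ⟨y, hNU' hy⟩).imp (fun h => ⟨_, _, h⟩)
      fun h => ⟨_, _, h⟩)
  refine ⟨N, hN, hNU.trans inter_subset_right, L, ?_, ?_⟩
  · intro y hy
    obtain ⟨T, hT, hTU⟩ := hIic ⟨y, hNU' hy⟩
    have : N ∩ Iic y = N ∩ T := by
      ext z
      refine and_congr_right fun hz => ?_
      rw [hTU ⟨z, hNU' hz⟩, mem_Iic, hL z hz y hy]
      exact ⟨fun ⟨_, _, h⟩ => h, fun h => ⟨_, _, h⟩⟩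
    rw [this]
    exact hNc.inter hT
  · intro y hy
    obtain ⟨T, hT, hTU⟩ := hIci ⟨y, hNU' hy⟩
    have : N ∩ Ici y = N ∩ T := by
      ext z
      refine and_congr_right fun hz => ?_
      rw [hTU ⟨z, hNU' hz⟩, mem_Ici, hL y hy z hz]
      exact ⟨fun ⟨_, _, h⟩ => h, fun h => ⟨_, _, h⟩⟩
    rw [this]
    exact hNc.inter hT

/-- The trace of `A` on `C` is closed and relatively open; `interior (A ∪ Cᶜ)` is an open set of `Y`
with this trace. -/
theorem IsPreconnected.subset_of_forall_mem_nhdsWithin {C A : Set Y} (hC : IsPreconnected C)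
    (hA : IsClosed A) (hne : (C ∩ A).Nonempty) (h : ∀ z ∈ A, A ∈ 𝓝[C] z) : C ⊆ A := by
  intro y hy
  by_contra hyA
  have hsub : A ⊆ interior (A ∪ Cᶜ) := fun z hz => mem_interior_iff_mem_nhds.2 <| by
    obtain ⟨V, hV, hVA⟩ := mem_nhdsWithin_iff_exists_mem_nhds_inter.1 (h z hz)
    filter_upwards [hV] with w hw
    by_cases hwC : w ∈ C
    · exact Or.inl (hVA ⟨hw, hwC⟩)
    · exact Or.inr hwC
  obtain ⟨w, hwC, hw1, hw2⟩ := hC (interior (A ∪ Cᶜ)) Aᶜ isOpen_interior hA.isOpen_compl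
    (fun w _ => (em (w ∈ A)).imp (fun h => hsub h) id)
    (hne.mono (inter_subset_inter_right C hsub)) ⟨y, hy, hyA⟩
  rcases interior_subset hw1 with h | h
  exacts [hw2 h, h hwC]

namespace OrderedOn

/-- If `D` and `E` left `x` on the same side, the nearer of `d` and `e` would lie in both by
convexity. So they leave on opposite sides and fill an interval around `x`. -/
theorem union_mem_nhds [LinearOrder Y] {N D E : Set Y} {x d e : Y} (h : OrderedOn N)
    (hN : N ∈ 𝓝 x) (hD : IsPreconnected D) (hE : IsPreconnected E) (hDN : D ⊆ N) (hEN : E ⊆ N)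
    (hxD : x ∈ D) (hxE : x ∈ E) (hDE : D ∩ E ⊆ {x}) (hd : d ∈ D) (he : e ∈ E) (hdx : d ≠ x)
    (hex : e ≠ x) : D ∪ E ∈ 𝓝 x := by
  have opp : ∀ {D E : Set Y} {d e : Y}, IsPreconnected D → IsPreconnected E → D ⊆ N → E ⊆ N →
      x ∈ D → x ∈ E → d ∈ D → e ∈ E → d < x → x < e → D ∪ E ∈ 𝓝 x := by
    intro D E d e hD hE hDN hEN hxD hxE hd he hdx hxe
    have h1 := h.Ioi_mem_nhdsWithin (hDN hd) hdx
    have h2 := h.Iio_mem_nhdsWithin (hEN he) hxe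
    rw [nhdsWithin_eq_nhds.2 hN] at h1 h2
    filter_upwards [hN, h1, h2] with z hz hz1 hz2
    rcases le_total z x with hzx | hzx
    · exact Or.inl (h.convex hD hDN hd hxD hz hz1.le hzx)
    · exact Or.inr (h.convex hE hEN hxE he hz hzx hz2.le)
  rcases lt_or_gt_of_ne hdx with h1 | h1 <;> rcases lt_or_gt_of_ne hex with h2 | h2
  · rcases le_total d e with hde | hde
    · exact absurd (hDE ⟨h.convex hD hDN hd hxD (hEN he) hde h2.le, he⟩) hex
    · exact absurd (hDE ⟨hd, h.convex hE hEN he hxE (hDN hd) hde h1.le⟩) hdx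
  · exact opp hD hE hDN hEN hxD hxE hd he h1 h2
  · rw [union_comm]
    exact opp hE hD hEN hDN hxE hxD he hd h2 h1
  · rcases le_total d e with hde | hde
    · exact absurd (hDE ⟨hd, h.convex hE hEN hxE he (hDN hd) h1.le hde⟩) hdx
    · exact absurd (hDE ⟨h.convex hD hDN hxD hd (hEN he) h2.le hde, he⟩) hex

variable [CompactSpace Y] [T2Space Y]

theorem exists_Icc_subset_left [LinearOrder Y] {A W : Set Y} {a x : Y} (h : OrderedOn A)
    (hA : IsPreconnected A) (ha : a ∈ A) (hx : x ∈ A) (hax : a < x) (hW : W ∈ 𝓝 x) :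
    ∃ c ∈ A, a ≤ c ∧ c < x ∧ A ∩ Icc c x ⊆ W := by
  obtain ⟨V, hVW, hV, hxV⟩ := mem_nhds_iff.1 hW
  -- The last point before `x` outside `V`; adjoining `a` provides one even if the interval stays in
  -- `V`. Connectedness leaves room between `f` and `x`.
  obtain ⟨f, hf, hfmax⟩ := h.exists_isGreatest (B := A ∩ Icc a x ∩ Vᶜ ∪ {a})
    (union_subset (inter_subset_left.trans inter_subset_left) (singleton_subset_iff.2 ha))
    (((h.isClosed_Icc ha hx).inter hV.isClosed_compl).union isClosed_singleton)
    ⟨a, Or.inr rfl⟩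
  have hfa : a ≤ f := hfmax (Or.inr rfl)
  have hfA : f ∈ A := by
    rcases hf with hf | rfl
    exacts [hf.1.1, ha]
  have hfx : f < x := by
    rcases hf with hf | rfl
    · exact lt_of_le_of_ne hf.1.2.2 fun e => hf.2 (e ▸ hxV)
    · exact hax
  obtain ⟨c, hc, hfc, hcx⟩ := h.exists_between hA hfA hx hfx
  refine ⟨c, hc, hfa.trans hfc.le, hcx, fun z hz => hVW ?_⟩
  by_contra hzV
  exact not_lt.2 (hfmax (Or.inl ⟨⟨hz.1, (hfa.trans hfc.le).trans hz.2.1, hz.2.2⟩, hzV⟩))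
    (hfc.trans_le hz.2.1)

theorem exists_Icc_subset_right [LinearOrder Y] {A W : Set Y} {a x : Y} (h : OrderedOn A)
    (hA : IsPreconnected A) (ha : a ∈ A) (hx : x ∈ A) (hax : x < a) (hW : W ∈ 𝓝 x) :
    ∃ c ∈ A, c ≤ a ∧ x < c ∧ A ∩ Icc x c ⊆ W := by
  obtain ⟨c, hc, h1, h2, h3⟩ := @OrderedOn.exists_Icc_subset_left Y _ _ _
    (reverseOrder inferInstance) A W a x h.reverse hA ha hx hax hW
  exact ⟨c, hc, h1, h2, fun z hz => h3 ⟨hz.1, hz.2.2, hz.2.1⟩⟩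

/-- In a connected closed set with an ordered neighbourhood `N` of its point `x`, the
points of `N` to the left of `x` either form, near `x`, a connected set, or stay away from `x`. -/
theorem exists_isPreconnected_Icc_left [LinearOrder Y] {N C : Set Y} {x : Y} (h : OrderedOn N)
    (hN : N ∈ 𝓝 x) (hC : IsPreconnected C) (hCc : IsClosed C) (hx : x ∈ C) :
    ∃ l ∈ C ∩ N, l ≤ x ∧ IsPreconnected ((C ∩ N) ∩ Icc l x) ∧
      ∃ W ∈ 𝓝 x, ∀ z ∈ (C ∩ N) ∩ W, l ≤ z := by
  set M := C ∩ N with hM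
  have hMc : IsClosed M := hCc.inter h.isClosed
  have hMO : OrderedOn M := h.mono inter_subset_right hMc
  have hxM : x ∈ M := ⟨hx, mem_of_mem_nhds hN⟩
  have far : ∀ u ∈ M, u < x → (M ∩ Iic u)ᶜ ∈ 𝓝 x := fun u hu hux =>
    (hMO.isClosed_Iic u hu).isOpen_compl.mem_nhds fun hh => not_le.2 hux hh.2
  by_cases hgood : ∃ l ∈ M, l < x ∧ IsPreconnected (M ∩ Icc l x)
  · obtain ⟨l, hl, hlx, hlp⟩ := hgood
    exact ⟨l, hl, hlx.le, hlp, _, far l hl hlx, fun z hz =>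
      (not_le.1 fun hzl => hz.2 ⟨hz.1, hzl⟩).le⟩
  by_cases hiso : ∃ W ∈ 𝓝 x, ∀ z ∈ M ∩ W, x ≤ z
  · refine ⟨x, hxM, le_rfl, ?_, hiso⟩
    rw [Icc_self]
    exact (subsingleton_singleton.anti inter_subset_right).isPreconnected
  exfalso
  push Not at hgood hiso
  set V := interior N with hV
  have hxV : x ∈ V := mem_interior_iff_mem_nhds.2 hN
  -- Now points of `M` accumulate at `x` from the left and no interval ending at `x` is connected.
  -- Choose `l` so near that the interval from `l` to `x` stays in the interior of `N`.
  obtain ⟨l, hl, hlx, hlV⟩ : ∃ l ∈ M, l < x ∧ ∀ z ∈ M, l ≤ z → z ≤ x → z ∈ V := by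
    have hFc : IsClosed (M ∩ Iic x ∩ Vᶜ) :=
      (hMO.isClosed_Iic x hxM).inter isOpen_interior.isClosed_compl
    rcases (M ∩ Iic x ∩ Vᶜ).eq_empty_or_nonempty with hF | hF
    · obtain ⟨l, hl, hlx⟩ := hiso univ Filter.univ_mem
      refine ⟨l, hl.1, hlx, fun z hz _ hzx => ?_⟩
      by_contra hzV
      exact (hF ▸ (⟨⟨hz, hzx⟩, hzV⟩ : z ∈ M ∩ Iic x ∩ Vᶜ) : z ∈ (∅ : Set Y))
    · obtain ⟨f, hf, hfmax⟩ := hMO.exists_isGreatest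
        (inter_subset_left.trans inter_subset_left) hFc hF
      have hfx : f < x := lt_of_le_of_ne hf.1.2 fun e => hf.2 (e ▸ hxV)
      obtain ⟨l, hl, hlx⟩ := hiso _ (far f hf.1.1 hfx)
      have hfl : f < l := not_le.1 fun hle => hl.2 ⟨hl.1, hle⟩
      refine ⟨l, hl.1, hlx, fun z hz hlz hzx => ?_⟩
      by_contra hzV
      exact not_lt.2 (hfmax ⟨⟨hz, hzx⟩, hzV⟩) (hfl.trans_le hlz)
  obtain ⟨u₁, hu₁, v₁, hv₁, hlu₁, huv₁, hv₁x, hjump₁⟩ :=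
    hMO.exists_jump hl hxM (hgood l hl hlx)
  have hv₁x' : v₁ < x := by
    refine lt_of_le_of_ne hv₁x ?_
    rintro rfl
    obtain ⟨z, hz, hzx⟩ := hiso _ (far u₁ hu₁ huv₁)
    rcases hjump₁ z hz.1 with h' | h'
    · exact hz.2 ⟨hz.1, h'⟩
    · exact not_lt.2 h' hzx
  obtain ⟨u₂, hu₂, v₂, hv₂, hvu, huv₂, hv₂x, hjump₂⟩ :=
    hMO.exists_jump hv₁ hxM (hgood v₁ hv₁ hv₁x')
  -- The block of `M` between the two jumps lies in `V`, away from the boundary of `N`. It is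
  -- therefore a proper clopen part of the connected set `C`.
  obtain ⟨w, hwC, hw1, hw2⟩ := isPreconnected_closed_iff.1 hC (M ∩ Icc v₁ u₂)
    (M ∩ Iic u₁ ∪ M ∩ Ici v₂ ∪ C ∩ Vᶜ) (hMO.isClosed_Icc hv₁ hu₂)
    (((hMO.isClosed_Iic u₁ hu₁).union (hMO.isClosed_Ici v₂ hv₂)).union
      (hCc.inter isOpen_interior.isClosed_compl))
    (fun z hz => by
      by_cases hzV : z ∈ V
      · have hzM : z ∈ M := ⟨hz, interior_subset hzV⟩
        rcases hjump₁ z hzM with h1 | h1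
        · exact Or.inr (Or.inl (Or.inl ⟨hzM, h1⟩))
        rcases hjump₂ z hzM with h2 | h2
        · exact Or.inl ⟨hzM, h1, h2⟩
        · exact Or.inr (Or.inl (Or.inr ⟨hzM, h2⟩))
      · exact Or.inr (Or.inr ⟨hz, hzV⟩))
    ⟨v₁, hv₁.1, hv₁, le_rfl, hvu⟩ ⟨u₁, hu₁.1, Or.inl (Or.inl ⟨hu₁, le_rfl⟩)⟩
  rcases hw2 with (hw2 | hw2) | hw2
  · exact not_lt.2 (hw1.2.1.trans hw2.2) huv₁
  · exact not_lt.2 ((show v₂ ≤ w from hw2.2).trans hw1.2.2) huv₂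
  · exact hw2.2 (hlV w hw1.1 ((hlu₁.trans huv₁.le).trans hw1.2.1)
      (hw1.2.2.trans (huv₂.le.trans hv₂x)))

theorem exists_isPreconnected_Icc_right [LinearOrder Y] {N C : Set Y} {x : Y} (h : OrderedOn N)
    (hN : N ∈ 𝓝 x) (hC : IsPreconnected C) (hCc : IsClosed C) (hx : x ∈ C) :
    ∃ r ∈ C ∩ N, x ≤ r ∧ IsPreconnected ((C ∩ N) ∩ Icc x r) ∧
      ∃ W ∈ 𝓝 x, ∀ z ∈ (C ∩ N) ∩ W, z ≤ r := by
  obtain ⟨r, hr, hxr, hp, hW⟩ := @OrderedOn.exists_isPreconnected_Icc_left Y _ _ _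
    (reverseOrder inferInstance) N C x h.reverse hN hC hCc hx
  refine ⟨r, hr, hxr, ?_, hW⟩
  convert hp using 2
  ext z
  exact and_comm

end OrderedOn

variable [CompactSpace Y] [T2Space Y]

/-- An arc is a neighbourhood of each of its points other than its endpoints. -/
theorem IsArc.mem_nhds {A : Set Y} {a b x : Y} (hY : IsLocallyOrdered Y) (h : IsArc A a b)
    (hx : x ∈ A) (hxa : x ≠ a) (hxb : x ≠ b) : A ∈ 𝓝 x := by
  obtain ⟨_, hA, hc, hl, hg⟩ := h
  -- The orders of `A` and `N` need not agree. Only two connected arms of `A` at `x`, short enough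
  -- to lie in `N`, are compared with the order of `N`.
  obtain ⟨N, hN, -, hLN⟩ := hY.exists_orderedOn (Filter.univ_mem (f := 𝓝 x))
  obtain ⟨c, hcA, -, hcx, hcN⟩ := hA.exists_Icc_subset_left hc hl.1 hx
    (lt_of_le_of_ne (hl.2 hx) hxa.symm) hN
  obtain ⟨d, hdA, -, hxd, hdN⟩ := hA.exists_Icc_subset_right hc hg.1 hx
    (lt_of_le_of_ne (hg.2 hx) hxb) hN
  have hp := hA.isPreconnected_Icc hc hcA hx
  have hp' := hA.isPreconnected_Icc hc hx hdA
  have hi : (A ∩ Icc c x) ∩ (A ∩ Icc x d) ⊆ {x} := fun z hz => le_antisymm hz.1.2.2 hz.2.2.1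
  have m1 : x ∈ A ∩ Icc c x := ⟨hx, hcx.le, le_rfl⟩
  have m2 : x ∈ A ∩ Icc x d := ⟨hx, le_rfl, hxd.le⟩
  have m3 : c ∈ A ∩ Icc c x := ⟨hcA, le_rfl, hcx.le⟩
  have m4 : d ∈ A ∩ Icc x d := ⟨hdA, hxd.le, le_rfl⟩
  have hs : A ∩ Icc c x ∪ A ∩ Icc x d ⊆ A := union_subset inter_subset_left inter_subset_left
  have n1 := hcx.ne
  have n2 := hxd.ne'
  obtain ⟨LN, hLN⟩ := hLN
  exact Filter.mem_of_superset
    (@OrderedOn.union_mem_nhds Y _ LN N _ _ x c d hLN hN hp hp' hcN hdN m1 m2 hi m3 m4 n1 n2) hs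

/-- The two one-sided connected intervals at `x` join to an arc. Either side may reduce to `x`, so
the arc may be degenerate. -/
theorem IsLocallyOrdered.exists_isArc {C : Set Y} {x : Y} (hY : IsLocallyOrdered Y)
    (hC : IsPreconnected C) (hCc : IsClosed C) (hx : x ∈ C) :
    ∃ A a b, IsArc A a b ∧ A ⊆ C ∧ A ∈ 𝓝[C] x := by
  obtain ⟨N, hN, -, _, hNO⟩ := hY.exists_orderedOn (Filter.univ_mem (f := 𝓝 x))
  obtain ⟨l, hl, hlx, hlp, W, hW, hlW⟩ := hNO.exists_isPreconnected_Icc_left hN hC hCc hx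
  obtain ⟨r, hr, hxr, hrp, W', hW', hrW⟩ := hNO.exists_isPreconnected_Icc_right hN hC hCc hx
  have hMO : OrderedOn (C ∩ N) := hNO.mono inter_subset_right (hCc.inter hNO.isClosed)
  have hxM : x ∈ C ∩ N := ⟨hx, mem_of_mem_nhds hN⟩
  refine ⟨(C ∩ N) ∩ Icc l r, l, r, ⟨inferInstance, hMO.mono inter_subset_left
    (hMO.isClosed_Icc hl hr), ?_, ⟨⟨hl, le_rfl, hlx.trans hxr⟩, fun z hz => hz.2.1⟩,
    ⟨hr, hlx.trans hxr, le_rfl⟩, fun z hz => hz.2.2⟩, inter_subset_left.trans inter_subset_left, ?_⟩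
  · have : (C ∩ N) ∩ Icc l r = (C ∩ N) ∩ Icc l x ∪ (C ∩ N) ∩ Icc x r := by
      rw [← inter_union_distrib_left, Icc_union_Icc_eq_Icc hlx hxr]
    rw [this]
    exact hlp.union x ⟨hxM, hlx, le_rfl⟩ ⟨hxM, le_rfl, hxr⟩ hrp
  · filter_upwards [self_mem_nhdsWithin, mem_nhdsWithin_of_mem_nhds hN,
      mem_nhdsWithin_of_mem_nhds hW, mem_nhdsWithin_of_mem_nhds hW'] with z h1 h2 h3 h4
    exact ⟨⟨h1, h2⟩, hlW z ⟨⟨h1, h2⟩, h3⟩, hrW z ⟨⟨h1, h2⟩, h4⟩⟩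

end LocallyOrderedSpaces

/-! ### Components are arcs or loops -/

section Continua

open Set

variable {Y : Type u} [TopologicalSpace Y]

/-- A subset which is the union of two arcs with distinct endpoints `p` and `q`, one of which is
the given point, such that the arcs meet in `p` and `q` only. -/
def IsLoop (L : Set Y) (p : Y) : Prop :=
  ∃ A B q, p ≠ q ∧ IsArc A p q ∧ IsArc B p q ∧ A ∩ B ⊆ {p, q} ∧ L = A ∪ B

theorem IsLoop.isClosed {L : Set Y} {p : Y} (h : IsLoop L p) : IsClosed L := by
  obtain ⟨A, B, q, -, hA, hB, -, rfl⟩ := h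
  exact hA.isClosed.union hB.isClosed

theorem IsLoop.base_mem {L : Set Y} {p : Y} (h : IsLoop L p) : p ∈ L := by
  obtain ⟨A, B, q, -, hA, hB, -, rfl⟩ := h
  exact Or.inl hA.left_mem

theorem IsArc.exists_between {A : Set Y} {a b : Y} (h : IsArc A a b) (hab : a ≠ b) :
    ∃ m ∈ A, m ≠ a ∧ m ≠ b := by
  obtain ⟨_, hA, hc, hl, hg⟩ := h
  obtain ⟨m, hm, h1, h2⟩ := hA.exists_between hc hl.1 hg.1 (lt_of_le_of_ne (hl.2 hg.1) hab)
  exact ⟨m, hm, h1.ne', h2.ne⟩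

/-- `hend` says that `a` is an end of `D`, so by convexity `D` lies on the side of `c`. The germ `P`
is the opposite ray of `N`, oriented to end at `a`. -/
theorem OrderedOn.exists_germ [LinearOrder Y] {N D : Set Y} {a c : Y} (h : OrderedOn N)
    (hN : N ∈ 𝓝 a) (hD : IsPreconnected D) (hDN : D ⊆ N) (ha : a ∈ D) (hc : c ∈ D) (hca : c ≠ a)
    (hend : ∀ x ∈ D, x ≠ a → ∃ E ⊆ D, IsPreconnected E ∧ a ∉ E ∧ x ∈ E ∧ c ∈ E) :
    ∃ P ⊆ N, (∃ _ : LinearOrder Y, OrderedOn P ∧ ∀ x ∈ P, x ≤ a) ∧ a ∈ P ∧ P ∩ D ⊆ {a} ∧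
      P ∪ D ∈ 𝓝 a := by
  have key : ∀ L : LinearOrder Y, OrderedOn N → a < c →
      ∃ P ⊆ N, (∃ _ : LinearOrder Y, OrderedOn P ∧ ∀ x ∈ P, x ≤ a) ∧ a ∈ P ∧ P ∩ D ⊆ {a} ∧
      P ∪ D ∈ 𝓝 a := by
    intro L h hac
    refine ⟨N ∩ Iic a, inter_subset_left, ⟨inferInstance, h.mono inter_subset_left
      (h.isClosed_Iic a (hDN ha)), fun x hx => hx.2⟩, ⟨hDN ha, le_rfl⟩, ?_, ?_⟩
    · rintro x ⟨⟨hxN, hxa⟩, hxD⟩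
      by_contra hne
      obtain ⟨E, hED, hE, haE, hxE, hcE⟩ := hend x hxD hne
      exact haE (h.convex hE (hED.trans hDN) hxE hcE (hDN ha) hxa hac.le)
    · have h1 := h.Iio_mem_nhdsWithin (hDN hc) hac
      rw [nhdsWithin_eq_nhds.2 hN] at h1
      filter_upwards [hN, h1] with z hz hzc
      rcases le_total z a with hza | hza
      · exact Or.inl ⟨hz, hza⟩
      · exact Or.inr (h.convex hD hDN ha hc hz hza hzc.le)
  rcases lt_or_gt_of_ne hca with hlt | hlt
  · exact key (reverseOrder inferInstance) h.reverse hlt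
  · exact key _ h hlt

variable [CompactSpace Y] [T2Space Y]

/-- Split the arc through `t` into `D` from `p` to `t` and `E` from `t` to `q`; the new arcs from
`t` to `q` are `E` and `D ∪ B`. -/
theorem IsLoop.rotate {L : Set Y} {p t : Y} (h : IsLoop L p) (ht : t ∈ L) : IsLoop L t := by
  have key : ∀ A B : Set Y, ∀ q, p ≠ q → IsArc A p q → IsArc B p q → A ∩ B ⊆ {p, q} → t ∈ A →
      IsLoop (A ∪ B) t := by
    intro A B q hpq hA hB hAB ht
    by_cases htp : t = p
    · subst htp
      exact ⟨A, B, q, hpq, hA, hB, hAB, rfl⟩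
    by_cases htq : t = q
    · subst htq
      exact ⟨A, B, p, hpq.symm, hA.symm, hB.symm, by rwa [pair_comm], rfl⟩
    obtain ⟨D, E, rfl, hDE, hD, hE⟩ := hA.split ht
    have hEB : ∀ z ∈ E, z ∈ B → z = q := fun z hzE hzB => by
      rcases hAB ⟨Or.inr hzE, hzB⟩ with rfl | h
      · exact absurd (hDE.subset ⟨hD.left_mem, hzE⟩).symm htp
      · exact h
    refine ⟨E, D ∪ B, q, htq, hE, hD.symm.glue hB ?_, ?_, ?_⟩
    · rintro z ⟨hzD, hzB⟩
      rcases hAB ⟨Or.inl hzD, hzB⟩ with h | h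
      · exact h
      · rw [mem_singleton_iff] at h
        subst h
        exact absurd (hDE.subset ⟨hzD, hE.right_mem⟩).symm htq
    · rintro z ⟨hzE, hzD | hzB⟩
      · exact Or.inl (hDE.subset ⟨hzD, hzE⟩)
      · exact Or.inr (hEB z hzE hzB)
    · rw [← union_assoc, union_comm E D]
  obtain ⟨A, B, q, hpq, hA, hB, hAB, rfl⟩ := h
  rcases ht with ht | ht
  · exact key A B q hpq hA hB hAB ht
  · rw [union_comm]
    exact key B A q hpq hB hA (by rwa [inter_comm]) ht

/-- After rotation to `t`, an arc running from inside one side through `t` into the other has `t` as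
a non-end point. -/
theorem IsLoop.isClopen {L : Set Y} {p : Y} (hY : IsLocallyOrdered Y) (h : IsLoop L p) :
    IsClopen L := by
  refine ⟨h.isClosed, isOpen_iff_mem_nhds.2 fun t ht => ?_⟩
  obtain ⟨A, B, q, hpq, hA, hB, hAB, rfl⟩ := h.rotate ht
  obtain ⟨m, hm, hmt, hmq⟩ := hA.exists_between hpq
  obtain ⟨n, hn, hnt, hnq⟩ := hB.exists_between hpq
  obtain ⟨A₁, A₂, rfl, hA₁₂, hA₁, hA₂⟩ := hA.split hm
  obtain ⟨B₁, B₂, rfl, hB₁₂, hB₁, hB₂⟩ := hB.split hn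
  have hg : IsArc (B₁ ∪ A₁) n m := hB₁.symm.glue hA₁ fun z hz => by
    rcases hAB ⟨Or.inl hz.2, Or.inl hz.1⟩ with h | h
    · exact h
    · rw [mem_singleton_iff] at h
      subst h
      exact absurd (hA₁₂.subset ⟨hz.2, hA₂.right_mem⟩).symm hmq
  refine Filter.mem_of_superset (hg.mem_nhds hY (Or.inl hB₁.left_mem) hnt.symm hmt.symm) ?_
  exact union_subset (subset_union_left.trans subset_union_right)
    (subset_union_left.trans subset_union_left)

/-- Run along `B` from `e` to the first point `y` of `A`. Since `B` reaches `y` from outside `A`,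
`y` is an end of `A`, and this piece of `B` can be attached there. -/
theorem IsArc.extend {A B : Set Y} {a b e e' : Y} (hY : IsLocallyOrdered Y) (hA : IsArc A a b)
    (hB : IsArc B e e') (hAB : (A ∩ B).Nonempty) :
    ∃ A' a' b', IsArc A' a' b' ∧ A ⊆ A' ∧ e ∈ A' ∧ A' ⊆ A ∪ B := by
  by_cases heA : e ∈ A
  · exact ⟨A, a, b, hA, Subset.rfl, heA, subset_union_left⟩
  obtain ⟨_, hBO, hBc, hl, hg⟩ := hB
  obtain ⟨y, hy, hymin⟩ := hBO.exists_isLeast (B := A ∩ B) inter_subset_right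
    (hA.isClosed.inter hBO.isClosed) hAB
  have hey : e < y := lt_of_le_of_ne (hl.2 hy.2) fun h => heA (h ▸ hy.1)
  have hyn : A ∉ 𝓝 y := fun hn => by
    obtain ⟨c, hc, -, hcy, hcA⟩ := hBO.exists_Icc_subset_left hBc hl.1 hy.2 hey hn
    exact not_lt.2 (hymin ⟨hcA ⟨hc, le_rfl, hcy.le⟩, hc⟩) hcy
  have hD := hBO.isArc_Icc hBc hl.1 hy.2 hey.le
  have hDA : (B ∩ Icc e y) ∩ A ⊆ {y} := fun z hz =>
    le_antisymm hz.1.2.2 (hymin ⟨hz.2, hz.1.1⟩)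
  have hyab : y = a ∨ y = b := by
    by_contra! hcon
    exact hyn (hA.mem_nhds hY hy.1 hcon.1 hcon.2)
  have hsub : B ∩ Icc e y ∪ A ⊆ A ∪ B :=
    union_subset (inter_subset_left.trans subset_union_right) subset_union_left
  rcases hyab with rfl | rfl
  · exact ⟨_, e, b, hD.glue hA hDA, subset_union_right, Or.inl hD.left_mem, hsub⟩
  · exact ⟨_, e, a, hD.glue hA.symm hDA, subset_union_right, Or.inl hD.left_mem, hsub⟩

/-- An excursion of `B` outside `A` starts and finishes at points where `A` is not a neighbourhood,
so at the two ends of `A`; it closes `A` to a loop. -/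
theorem IsArc.exists_isLoop {A B : Set Y} {a b e e' : Y} (hY : IsLocallyOrdered Y)
    (hA : IsArc A a b) (hB : IsArc B e e') (he : e ∈ A) (he' : e' ∈ A) (hBA : ¬ B ⊆ A) :
    ∃ L, IsLoop L a ∧ L ⊆ A ∪ B := by
  obtain ⟨z, hzB, hzA⟩ := not_subset.1 hBA
  obtain ⟨_, hBO, hBc, hl, hg⟩ := hB
  obtain ⟨x, hx, hxmax⟩ := hBO.exists_isGreatest (B := A ∩ (B ∩ Iic z))
    (inter_subset_right.trans inter_subset_left) (hA.isClosed.inter (hBO.isClosed_Iic z hzB))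
    ⟨e, he, hl.1, hl.2 hzB⟩
  obtain ⟨y, hy, hymin⟩ := hBO.exists_isLeast (B := A ∩ (B ∩ Ici z))
    (inter_subset_right.trans inter_subset_left) (hA.isClosed.inter (hBO.isClosed_Ici z hzB))
    ⟨e', he', hg.1, hg.2 hzB⟩
  have hxz : x < z := lt_of_le_of_ne hx.2.2 fun h => hzA (h ▸ hx.1)
  have hzy : z < y := lt_of_le_of_ne hy.2.2 fun h => hzA (h ▸ hy.1)
  have hxn : A ∉ 𝓝 x := fun hn => by
    obtain ⟨c, hc, hcz, hxc, hcA⟩ := hBO.exists_Icc_subset_right hBc hzB hx.2.1 hxz hn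
    exact not_lt.2 (hxmax ⟨hcA ⟨hc, hxc.le, le_rfl⟩, hc, hcz⟩) hxc
  have hyn : A ∉ 𝓝 y := fun hn => by
    obtain ⟨c, hc, hzc, hcy, hcA⟩ := hBO.exists_Icc_subset_left hBc hzB hy.2.1 hzy hn
    exact not_lt.2 (hymin ⟨hcA ⟨hc, le_rfl, hcy.le⟩, hc, hzc⟩) hcy
  have hxab : x = a ∨ x = b := by
    by_contra! hcon
    exact hxn (hA.mem_nhds hY hx.1 hcon.1 hcon.2)
  have hyab : y = a ∨ y = b := by
    by_contra! hcon
    exact hyn (hA.mem_nhds hY hy.1 hcon.1 hcon.2)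
  have hxy : x ≠ y := (hxz.trans hzy).ne
  have hJ := hBO.isArc_Icc hBc hx.2.1 hy.2.1 (hxz.trans hzy).le
  have hJA : A ∩ (B ∩ Icc x y) ⊆ {x, y} := by
    rintro w ⟨hwA, hwB, hxw, hwy⟩
    rcases le_total w z with h | h
    · exact Or.inl (le_antisymm (hxmax ⟨hwA, hwB, h⟩) hxw)
    · exact Or.inr (le_antisymm hwy (hymin ⟨hwA, hwB, h⟩))
  have hsub : A ∪ B ∩ Icc x y ⊆ A ∪ B := union_subset_union_right A inter_subset_left
  rcases hxab with rfl | rfl <;> rcases hyab with rfl | rfl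
  · exact absurd rfl hxy
  · exact ⟨_, ⟨A, B ∩ Icc x y, y, hxy, hA, hJ, hJA, rfl⟩, hsub⟩
  · exact ⟨_, ⟨A, B ∩ Icc x y, x, hxy.symm, hA, hJ.symm, by rwa [pair_comm], rfl⟩, hsub⟩
  · exact absurd rfl hxy

theorem IsLocallyOrdered.isArc_or_isLoop {C : Set Y} (hY : IsLocallyOrdered Y)
    (hC : IsPreconnected C) (hCc : IsClosed C) (hCn : C.Nonempty) :
    (∃ a b, IsArc C a b) ∨ ∃ p, IsLoop C p := by
  choose! N a b hN hNC hNn using fun x (hx : x ∈ C) => hY.exists_isArc hC hCc hx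
  obtain ⟨t, htC, ht⟩ := hCc.isCompact.elim_nhds_subcover (fun x => interior (N x ∪ Cᶜ))
    (fun x hx => interior_mem_nhds.2 <| by
      obtain ⟨V, hV, hVA⟩ := mem_nhdsWithin_iff_exists_mem_nhds_inter.1 (hNn x hx)
      filter_upwards [hV] with w hw
      by_cases hwC : w ∈ C
      · exact Or.inl (hVA ⟨hw, hwC⟩)
      · exact Or.inr hwC)
  -- Maximality is measured by which of the finitely many covering arcs are swallowed, not by
  -- inclusion of arcs, so it is attained for free.
  let 𝒯 : Set (Finset Y) :=
    {T | T ⊆ t ∧ ∃ A a b, IsArc A a b ∧ A ⊆ C ∧ ∀ i ∈ T, N i ⊆ A}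
  obtain ⟨x₀, hx₀⟩ := hCn
  have h𝒯 : 𝒯.Finite := t.powerset.finite_toSet.subset fun T hT => by simpa using hT.1
  obtain ⟨T, hT⟩ := h𝒯.exists_maximal
    ⟨∅, by simp, N x₀, a x₀, b x₀, hN x₀ hx₀, hNC x₀ hx₀, by simp⟩
  obtain ⟨hTt, A, p, q, hA, hAC, hTA⟩ := hT.prop
  by_cases hCA : C ⊆ A
  · exact Or.inl ⟨p, q, (hAC.antisymm hCA) ▸ hA⟩
  right
  obtain ⟨z, hz, hzn⟩ : ∃ z ∈ A, A ∉ 𝓝[C] z := by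
    by_contra! hcon
    exact hCA (hC.subset_of_forall_mem_nhdsWithin hA.isClosed
      ⟨p, hAC hA.left_mem, hA.left_mem⟩ hcon)
  obtain ⟨i, hi, hzi⟩ := mem_iUnion₂.1 (ht (hAC hz))
  have hiC := htC i hi
  have hzN : z ∈ N i := (interior_subset hzi).resolve_right fun h => h (hAC hz)
  have hiA : ¬ N i ⊆ A := fun hsub => hzn <| by
    filter_upwards [self_mem_nhdsWithin,
      mem_nhdsWithin_of_mem_nhds (mem_interior_iff_mem_nhds.1 hzi)] with w hw hwU
    exact hsub (hwU.resolve_right fun h => h hw)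
  have hB := hN i hiC
  -- Extend `A` to contain both ends of `N i`. If all of `N i` is then swallowed, maximality fails;
  -- otherwise an excursion of `N i` makes a loop, which is clopen and so equals `C`.
  obtain ⟨A₁, p₁, q₁, hA₁, hAA₁, he₁, hs₁⟩ := hA.extend hY hB ⟨z, hz, hzN⟩
  obtain ⟨A₂, p₂, q₂, hA₂, hAA₂, he₂, hs₂⟩ := hA₁.extend hY hB.symm ⟨z, hAA₁ hz, hzN⟩
  have hA₁C : A₁ ⊆ C := hs₁.trans (union_subset hAC (hNC i hiC))
  have hA₂C : A₂ ⊆ C := hs₂.trans (union_subset hA₁C (hNC i hiC))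
  by_cases hiA₂ : N i ⊆ A₂
  · classical
    have hins : insert i T ∈ 𝒯 := by
      refine ⟨Finset.insert_subset hi hTt, A₂, p₂, q₂, hA₂, hA₂C, fun j hj => ?_⟩
      rcases Finset.mem_insert.1 hj with rfl | hj
      · exact hiA₂
      · exact (hTA j hj).trans (hAA₁.trans hAA₂)
    exact absurd (hTA i (hT.le_of_ge hins (Finset.subset_insert i T) (Finset.mem_insert_self i T)))
      hiA
  · obtain ⟨L, hL, hLs⟩ := hA₂.exists_isLoop hY hB (hAA₂ he₁) he₂ hiA₂
    have hLC : L ⊆ C := hLs.trans (union_subset hA₂C (hNC i hiC))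
    have hCL : C ⊆ L := hC.subset_isClopen (hL.isClopen hY) ⟨p₂, hLC hL.base_mem, hL.base_mem⟩
    exact ⟨p₂, hLC.antisymm hCL ▸ hL⟩

theorem IsArc.exists_germ {C O : Set Y} {a b : Y} (hY : IsLocallyOrdered Y) (hC : IsArc C a b)
    (hab : a ≠ b) (hO : O ∈ 𝓝 a) :
    ∃ P ⊆ O, (∃ _ : LinearOrder Y, OrderedOn P ∧ ∀ x ∈ P, x ≤ a) ∧ a ∈ P ∧ P ∩ C ⊆ {a} ∧
      P ∪ C ∈ 𝓝 a := by
  obtain ⟨N, hN, hNO, hNL⟩ := hY.exists_orderedOn hO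
  obtain ⟨_, hCO, hCc, hl, hg⟩ := hC
  obtain ⟨c, hc, -, hac, hcN⟩ := hCO.exists_Icc_subset_right hCc hg.1 hl.1
    (lt_of_le_of_ne (hl.2 hg.1) hab) hN
  have hend : ∀ x ∈ C ∩ Icc a c, x ≠ a →
      ∃ E ⊆ C ∩ Icc a c, IsPreconnected E ∧ a ∉ E ∧ x ∈ E ∧ c ∈ E := fun x hx hxa =>
    ⟨C ∩ Icc x c, fun z hz => ⟨hz.1, hx.2.1.trans hz.2.1, hz.2.2⟩, hCO.isPreconnected_Icc hCc hx.1 hc,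
      fun h => hxa (le_antisymm h.2.1 hx.2.1), ⟨hx.1, le_rfl, hx.2.2⟩, hc, hx.2.2, le_rfl⟩
  have hDp := hCO.isPreconnected_Icc hCc hl.1 hc
  have haD : a ∈ C ∩ Icc a c := ⟨hl.1, le_rfl, hac.le⟩
  have hcD : c ∈ C ∩ Icc a c := ⟨hc, hac.le, le_rfl⟩
  have hR : (C ∩ Ici c)ᶜ ∈ 𝓝 a := (hCO.isClosed_Ici c hc).isOpen_compl.mem_nhds
    fun h => not_le.2 hac h.2
  have hcov : C ⊆ C ∩ Icc a c ∪ C ∩ Ici c := fun z hz =>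
    (le_total z c).imp (fun h => ⟨hz, hl.2 hz, h⟩) fun h => ⟨hz, h⟩
  have hDC : C ∩ Icc a c ⊆ C := inter_subset_left
  have hca := hac.ne'
  -- From here the order of `C` is irrelevant: `D` is a short initial arc and `R` the rest of `C`,
  -- which stays away from `a`.
  generalize C ∩ Icc a c = D at *
  generalize C ∩ Ici c = R at *
  obtain ⟨LN, hLN⟩ := hNL
  obtain ⟨P, hPN, ⟨LP, hPO, hPa⟩, haP, hPD, hPn⟩ :=
    @OrderedOn.exists_germ Y _ LN N D a c hLN hN hDp hcN haD hcD hca hend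
  -- Shrinking `P` into `K` keeps it off the rest of the arc, which may return to `N` farther from
  -- `a`.
  obtain ⟨K, hK, hKc, hKR⟩ := exists_mem_nhds_isClosed_subset hR
  refine ⟨P ∩ K, (inter_subset_left.trans hPN).trans hNO,
    ⟨LP, hPO.mono inter_subset_left (hPO.isClosed.inter hKc), fun x hx => hPa x hx.1⟩,
    ⟨haP, mem_of_mem_nhds hK⟩, ?_, ?_⟩
  · rintro x ⟨⟨hxP, hxK⟩, hxC⟩
    exact hPD ⟨hxP, (hcov hxC).resolve_right (hKR hxK)⟩
  · filter_upwards [hPn, hK] with z hz hzK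
    exact hz.imp (fun h => ⟨h, hzK⟩) fun h => hDC h

theorem IsArc.exists_orderedOn {C : Set Y} {a b : Y} (hY : IsLocallyOrdered Y) (hC : IsArc C a b)
    (hab : a ≠ b) : ∃ T, (∃ _ : LinearOrder Y, OrderedOn T) ∧ ∀ x ∈ C, T ∈ 𝓝 x := by
  obtain ⟨P, hPb, ⟨LP, hPO, hPa⟩, haP, hPC, hPn⟩ :=
    hC.exists_germ hY hab (isOpen_compl_singleton.mem_nhds hab : ({b}ᶜ : Set Y) ∈ 𝓝 a)
  have hPc : IsClosed P := hPO.isClosed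
  -- The germ at `b` is taken off `P`, possible since `P` avoids `b`. Its order is reversed below so
  -- that it starts at `b`.
  obtain ⟨Q, hQP, ⟨LQ, hQO, hQb⟩, hbQ, hQC, hQn⟩ :=
    hC.symm.exists_germ hY hab.symm (hPc.isOpen_compl.mem_nhds fun h => hPb h rfl)
  have hmid := fun x hx (hxa : x ≠ a) (hxb : x ≠ b) => hC.mem_nhds hY hx hxa hxb
  obtain ⟨LC, hCO, -, hl, hg⟩ := hC
  have hQO' := hQO.reverse
  obtain ⟨L, hO, -, h2, h3⟩ := hPO.glue hCO fun p hpP hpC => by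
    obtain rfl : p = a := hPC ⟨hpP, hpC⟩
    exact ⟨hPa, fun x hx => hl.2 hx⟩
  obtain ⟨L', hO', -⟩ := hO.glue hQO' fun p hpP hpQ => by
    have hpC : p ∈ C := hpP.resolve_left fun h => hQP hpQ h
    obtain rfl : p = b := hQC ⟨hpQ, hpC⟩
    refine ⟨?_, hQb⟩
    rintro x (hx | hx)
    · exact h3 x hx p hpC
    · exact (h2 x hx p hpC).2 (hg.2 hx)
  refine ⟨P ∪ C ∪ Q, ⟨L', hO'⟩, fun x hx => ?_⟩
  by_cases hxa : x = a
  · subst hxa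
    exact Filter.mem_of_superset hPn subset_union_left
  by_cases hxb : x = b
  · subst hxb
    refine Filter.mem_of_superset hQn ?_
    rw [union_assoc, union_comm Q]
    exact subset_union_right
  · exact Filter.mem_of_superset (hmid x hx hxa hxb)
      (subset_union_right.trans subset_union_left)

/-- The component is a directed intersection of clopen sets, so by compactness one of them already
lies in `T`. -/
theorem exists_isClopen_subset_of_connectedComponent {x : Y} {T : Set Y}
    (hT : ∀ y ∈ connectedComponent x, T ∈ 𝓝 y) : ∃ E, IsClopen E ∧ x ∈ E ∧ E ⊆ T := by
  rw [connectedComponent_eq_iInter_isClopen] at hT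
  have : Nonempty {s : Set Y // IsClopen s ∧ x ∈ s} := ⟨⟨univ, isClopen_univ, mem_univ x⟩⟩
  obtain ⟨E, hE⟩ := exists_subset_nhds_of_compactSpace
    (V := fun s : {s : Set Y // IsClopen s ∧ x ∈ s} => s.1)
    (fun s t => ⟨⟨s.1 ∩ t.1, s.2.1.inter t.2.1, s.2.2, t.2.2⟩, inter_subset_left,
      inter_subset_right⟩) (fun s => s.2.1.isClosed) hT
  exact ⟨E.1, E.2.1, E.2.2, hE⟩

theorem IsLocallyOrdered.exists_isClopen (hY : IsLocallyOrdered Y) (x : Y) :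
    ∃ E, IsClopen E ∧ x ∈ E ∧ ((∃ _ : LinearOrder Y, OrderedOn E) ∨ ∃ p, IsLoop E p) := by
  have ordered : ∀ T : Set Y, (∃ _ : LinearOrder Y, OrderedOn T) →
      (∀ y ∈ connectedComponent x, T ∈ 𝓝 y) →
      ∃ E, IsClopen E ∧ x ∈ E ∧ ((∃ _ : LinearOrder Y, OrderedOn E) ∨ ∃ p, IsLoop E p) := by
    rintro T ⟨L, hL⟩ hT
    obtain ⟨E, hE, hxE, hET⟩ := exists_isClopen_subset_of_connectedComponent hT
    exact ⟨E, hE, hxE, Or.inl ⟨L, hL.mono hET hE.isClosed⟩⟩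
  rcases hY.isArc_or_isLoop (isPreconnected_connectedComponent (x := x))
    isClosed_connectedComponent ⟨x, mem_connectedComponent⟩ with ⟨a, b, h⟩ | ⟨p, h⟩
  · by_cases hab : a = b
    -- A one-point component: any ordered neighbourhood of the point will do.
    · subst hab
      obtain ⟨N, hN, -, hNO⟩ := hY.exists_orderedOn (Filter.univ_mem (f := 𝓝 x))
      have hsub : ∀ y ∈ connectedComponent x, y = a := by
        obtain ⟨_, -, -, hl, hg⟩ := h
        exact fun y hy => le_antisymm (hg.2 hy) (hl.2 hy)
      exact ordered N hNO fun y hy => by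
        rwa [hsub y hy, ← hsub x mem_connectedComponent]
    · obtain ⟨T, hTO, hT⟩ := h.exists_orderedOn hY hab
      exact ordered T hTO hT
  · exact ⟨_, h.isClopen hY, mem_connectedComponent, Or.inr ⟨p, h⟩⟩

end Continua

/-! ### Suborderable spaces and their sums -/

section Suborderable

open Set

variable {X Y Z : Type u} [TopologicalSpace X] [TopologicalSpace Y] [TopologicalSpace Z]

theorem IsOrderable.of_homeomorph (h : IsOrderable Y) (e : X ≃ₜ Y) : IsOrderable X := by
  obtain ⟨LY, hY⟩ := h
  let LX : LinearOrder X := LinearOrder.lift' e e.injective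
  have hm : StrictMono e := fun x y hxy => hxy
  refine ⟨LX, ⟨?_⟩⟩
  rw [e.isInducing.eq_induced]
  exact hm.induced_topology_eq_preorder (by rw [e.surjective.range_eq]; exact ordConnected_univ)

theorem IsLocallyOrdered.of_isOpenEmbedding
    (h : ∀ y : Y, ∃ (Z : Type u) (_ : TopologicalSpace Z) (g : Z → Y),
      IsLocallyOrdered Z ∧ IsOpenEmbedding g ∧ y ∈ range g) : IsLocallyOrdered Y := by
  intro y
  obtain ⟨Z, _, g, hZ, hg, z, rfl⟩ := h y
  obtain ⟨U, hU, hUO⟩ := hZ z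
  exact ⟨g '' U, hg.image_mem_nhds.2 hU,
    hUO.of_homeomorph (hg.isEmbedding.homeomorphImage U).symm⟩

theorem IsOrderable.isLocallyOrdered (h : IsOrderable X) : IsLocallyOrdered X := fun _ =>
  ⟨univ, Filter.univ_mem, h.of_homeomorph (Homeomorph.Set.univ X)⟩

theorem orderedOn_univ [LinearOrder X] [OrderTopology X] : OrderedOn (univ : Set X) where
  isClosed_Iic x _ := by rw [univ_inter]; exact isClosed_Iic
  isClosed_Ici x _ := by rw [univ_inter]; exact isClosed_Ici

/-- A linearly ordered space embeds in its Dedekind completion. -/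
theorem isEmbedding_principal [LinearOrder X] [OrderTopology X]
    [TopologicalSpace (DedekindCut X)] [OrderTopology (DedekindCut X)] :
    IsEmbedding (DedekindCut.principal : X → DedekindCut X) := by
  refine ⟨⟨?_⟩, fun x y h => DedekindCut.principal_inj.1 h⟩
  rw [OrderTopology.topology_eq_generate_intervals (α := X)]
  refine (induced_topology_eq_preorder DedekindCut.principal_lt_principal ?_ ?_).symm
  -- A cut strictly below a point is bounded by the image of another point strictly below it, and
  -- dually, so rays at cuts induce nothing finer.
  · intro a b x hb _
    obtain ⟨y, hy, hya⟩ := DedekindCut.lt_principal_iff.1 hb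
    exact ⟨y, hya, DedekindCut.le_principal_iff.2 hy⟩
  · intro a b x hb _
    obtain ⟨y, hy, hya⟩ := DedekindCut.principal_lt_iff.1 hb
    exact ⟨y, hya, DedekindCut.principal_le_iff.2 hy⟩

theorem IsSuborderable.exists_compactSpace (h : IsSuborderable X) :
    ∃ (K : Type u) (_ : LinearOrder K) (_ : TopologicalSpace K),
      OrderTopology K ∧ CompactSpace K ∧ ∃ f : X → K, IsEmbedding f := by
  obtain ⟨Y, _, ⟨_, _⟩, f, hf⟩ := h
  let _ : TopologicalSpace (DedekindCut Y) := Preorder.topology _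
  have : OrderTopology (DedekindCut Y) := ⟨rfl⟩
  exact ⟨DedekindCut Y, inferInstance, inferInstance, inferInstance, inferInstance, _,
    isEmbedding_principal.comp hf⟩

theorem IsOrderable.isSuborderable (h : IsOrderable X) : IsSuborderable X :=
  ⟨X, inferInstance, h, id, IsEmbedding.id⟩

theorem IsSuborderable.of_isEmbedding {f : X → Y} (h : IsSuborderable Y) (hf : IsEmbedding f) :
    IsSuborderable X := by
  obtain ⟨Z, _, hZ, g, hg⟩ := h
  exact ⟨Z, inferInstance, hZ, g ∘ f, hg.comp hf⟩

theorem OrderedOn.isSuborderable [CompactSpace Y] [T2Space Y] [LinearOrder Y] {A B : Set Y}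
    (h : OrderedOn A) (hBA : B ⊆ A) : IsSuborderable B :=
  (h.isOrderable h.isClosed.isCompact).isSuborderable.of_isEmbedding (IsEmbedding.inclusion hBA)

theorem isEmbedding_sumMap {W : Type u} [TopologicalSpace W] {f : X → Y} {g : Z → W}
    (hf : IsEmbedding f) (hg : IsEmbedding g) : IsEmbedding (Sum.map f g) := by
  refine IsEmbedding.sumElim_of_separatedNhds (IsEmbedding.inl.comp hf) (IsEmbedding.inr.comp hg)
    ⟨range Sum.inl, range Sum.inr, isOpen_range_inl, isOpen_range_inr, range_comp_subset_range _ _,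
      range_comp_subset_range _ _, isCompl_range_inl_range_inr.disjoint⟩

/-- Enlarge both spaces to compact ordered ones and place one before the other; compactness turns
closed rays into the order topology. -/
theorem IsSuborderable.sum (hX : IsSuborderable X) (hY : IsSuborderable Y) :
    IsSuborderable (X ⊕ Y) := by
  obtain ⟨K, _, _, _, _, f, hf⟩ := hX.exists_compactSpace
  obtain ⟨M, _, _, _, _, g, hg⟩ := hY.exists_compactSpace
  obtain ⟨L₁, h₁, -⟩ := (orderedOn_univ (X := K)).image (g := (Sum.inl : K → K ⊕ M))
    continuous_inl.continuousOn Sum.inl_injective.injOn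
  obtain ⟨L₂, h₂, -⟩ := (orderedOn_univ (X := M)).image (g := (Sum.inr : M → K ⊕ M))
    continuous_inr.continuousOn Sum.inr_injective.injOn
  obtain ⟨L, hL, -⟩ := h₁.glue h₂ (by
    rintro _ ⟨x, -, rfl⟩ ⟨y, -, h⟩
    exact absurd h Sum.inr_ne_inl)
  have hu : (Sum.inl '' univ ∪ Sum.inr '' univ : Set (K ⊕ M)) = univ := by
    rw [image_univ, image_univ, range_inl_union_range_inr]
  rw [hu] at hL
  exact ((hL.isOrderable isCompact_univ).of_homeomorph
    (Homeomorph.Set.univ (K ⊕ M)).symm).isSuborderable.of_isEmbedding (isEmbedding_sumMap hf hg)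

theorem IsSuborderable.of_isClopen {A : Set X} (hA : IsClopen A) (h : IsSuborderable A)
    (h' : IsSuborderable (Aᶜ : Set X)) : IsSuborderable X := by
  classical
  let e : A ⊕ (Aᶜ : Set X) ≃ X := Equiv.Set.sumCompl A
  have hc : Continuous e := continuous_sumElim.2
    ⟨continuous_subtype_val, continuous_subtype_val⟩
  have ho : IsOpenMap e := isOpenMap_sumElim.2
    ⟨hA.isOpen.isOpenMap_subtype_val, hA.compl.isOpen.isOpenMap_subtype_val⟩
  exact (h.sum h').of_isEmbedding
    (e.toHomeomorphOfContinuousOpen hc ho).symm.isEmbedding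

theorem IsSuborderable.union {A S T : Set X} (hA : IsClopen A) (hS : IsSuborderable S)
    (hT : IsSuborderable T) (hSA : S ⊆ A) (hTA : Disjoint T A) :
    IsSuborderable (S ∪ T : Set X) := by
  refine IsSuborderable.of_isClopen (A := (Subtype.val : (S ∪ T : Set X) → X) ⁻¹' A)
    (hA.preimage continuous_subtype_val)
    (hS.of_isEmbedding ((IsEmbedding.subtypeVal.comp IsEmbedding.subtypeVal).codRestrict S fun x =>
      x.1.2.resolve_right fun h => disjoint_left.1 hTA h x.2))
    (hT.of_isEmbedding ((IsEmbedding.subtypeVal.comp IsEmbedding.subtypeVal).codRestrict T fun x =>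
      x.1.2.resolve_left fun h => x.2 (hSA h)))

end Suborderable

/-! ### Loops as quotients, and cut loops -/

section Loops

open Set

variable {X Y : Type u} [TopologicalSpace X] [TopologicalSpace Y]

/-- A loop is the image of an ordered continuum, under a map which identifies the endpoints and is
otherwise injective. -/
theorem IsLoop.exists_parametrization [CompactSpace Y] [T2Space Y] {L : Set Y} {p : Y}
    (h : IsLoop L p) :
    ∃ (K : Type u) (_ : LinearOrder K) (_ : TopologicalSpace K) (g : K → Y),
      OrderTopology K ∧ CompactSpace K ∧ ConnectedSpace K ∧ Nontrivial K ∧ Continuous g ∧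
      range g = L ∧ (∀ x y, IsBot x → IsTop y → g x = p ∧ g y = p) ∧
      ∀ x y, g x = g y → x = y ∨ (IsBot x ∧ IsTop y) ∨ (IsBot y ∧ IsTop x) := by
  obtain ⟨A, B, q, hpq, hA, hB, hAB, rfl⟩ := h
  -- In `Y × Y`, put `A` on the diagonal and `B` at height `q`. The copies meet only at `(q, q)`, so
  -- they glue to an arc from `(p, p)` to `(p, q)`, and the first projection closes it up again.
  have hA' := hA.image (g := fun x => (x, x)) (by fun_prop)
    (fun x _ y _ h => congrArg Prod.fst h)
  have hB' := hB.image (g := fun x => (x, q)) (by fun_prop)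
    (fun x _ y _ h => congrArg Prod.fst h)
  have hK := hA'.glue hB'.symm (by
    rintro _ ⟨⟨x, hx, rfl⟩, y, hy, h⟩
    simp only [Prod.mk.injEq] at h
    simp [← h.2])
  set K : Set (Y × Y) := (fun x => (x, x)) '' A ∪ (fun x => (x, q)) '' B with hKdef
  obtain ⟨_, hKO, hKc, hKl, hKg⟩ := hK
  have hbot : ∀ x : K, x.1 = (p, p) → IsBot x := fun x hx y =>
    Subtype.coe_le_coe.1 (hx ▸ hKl.2 y.2)
  have htop : ∀ x : K, x.1 = (p, q) → IsTop x := fun x hx y =>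
    Subtype.coe_le_coe.1 (hx ▸ hKg.2 y.2)
  have hKcpt := hKO.isClosed.isCompact
  refine ⟨K, inferInstance, inferInstance, fun x => x.1.1, hKO.orderTopology hKcpt,
    isCompact_iff_compactSpace.1 hKcpt, isConnected_iff_connectedSpace.1 ⟨⟨_, hKl.1⟩, hKc⟩,
    ⟨⟨⟨_, hKl.1⟩, ⟨_, hKg.1⟩, fun h => hpq (congrArg (fun z : K => z.1.2) h)⟩⟩, by fun_prop,
    ?_, ?_, ?_⟩
  · ext z
    constructor
    · rintro ⟨⟨x, ⟨y, hy, rfl⟩ | ⟨y, hy, rfl⟩⟩, rfl⟩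
      exacts [Or.inl hy, Or.inr hy]
    · rintro (hz | hz)
      · exact ⟨⟨(z, z), Or.inl ⟨z, hz, rfl⟩⟩, rfl⟩
      · exact ⟨⟨(z, q), Or.inr ⟨z, hz, rfl⟩⟩, rfl⟩
  · intro x y hx hy
    have h1 : x = ⟨(p, p), hKl.1⟩ := le_antisymm (hx _) (hbot _ rfl x)
    have h2 : y = ⟨(p, q), hKg.1⟩ := le_antisymm (htop _ rfl y) (hy _)
    rw [h1, h2]
    exact ⟨rfl, rfl⟩
  · rintro ⟨x, hx⟩ ⟨y, hy⟩ hxy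
    have cross : ∀ z ∈ A, z ∈ B → (z, z) ≠ (z, q) → z = p := fun z hzA hzB hne => by
      rcases hAB ⟨hzA, hzB⟩ with h | h
      · exact h
      · exact absurd (by rw [mem_singleton_iff.1 h]) hne
    by_cases heq : x = y
    · exact Or.inl (Subtype.ext heq)
    right
    rcases hx with ⟨z, hz, rfl⟩ | ⟨z, hz, rfl⟩ <;> rcases hy with ⟨w, hw, rfl⟩ | ⟨w, hw, rfl⟩ <;>
      obtain rfl : z = w := hxy
    · exact absurd rfl heq
    · obtain rfl := cross z hz hw heq
      exact Or.inl ⟨hbot _ rfl, htop _ rfl⟩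
    · obtain rfl := cross z hw hz (Ne.symm heq)
      exact Or.inr ⟨hbot _ rfl, htop _ rfl⟩
    · exact absurd rfl heq

theorem IsLoop.isLoopOrdered [CompactSpace Y] [T2Space Y] {L : Set Y} {p : Y} (h : IsLoop L p) :
    IsLoopOrdered L := by
  obtain ⟨K, _, _, g, h1, h2, h3, h4, hg, rfl, hend, hinj⟩ := h.exists_parametrization
  refine ⟨K, inferInstance, inferInstance, h1, h2, h3, h4, ?_⟩
  let φ : EndpointQuotient K → range g := Quot.lift (rangeFactorization g) fun x y hxy =>
    Subtype.ext ((hend x y hxy.1 hxy.2).1.trans (hend x y hxy.1 hxy.2).2.symm)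
  have hφ : Continuous φ := continuous_quot_lift _ (hg.subtype_mk _)
  have hb : Function.Bijective φ := by
    constructor
    · rintro ⟨x⟩ ⟨y⟩ hxy
      rcases hinj x y (congrArg Subtype.val hxy) with rfl | h | h
      · rfl
      · exact Quot.sound h
      · exact (Quot.sound (r := fun x y : K => IsBot x ∧ IsTop y) h).symm
    · rintro ⟨_, x, rfl⟩
      exact ⟨Quot.mk _ x, rfl⟩
  exact ⟨(Continuous.homeoOfEquivCompactToT2 (f := Equiv.ofBijective φ hb) hφ).symm⟩

/-- Away from the base point the parametrization is injective and closed, so `T` is homeomorphic to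
its preimage in `K`. -/
theorem IsLoop.isSuborderable [CompactSpace Y] [T2Space Y] {L T : Set Y} {p : Y}
    (h : IsLoop L p) (hTL : T ⊆ L) (hp : p ∉ T) : IsSuborderable T := by
  obtain ⟨K, _, _, g, h1, h2, h3, h4, hg, rfl, hend, hinj⟩ := h.exists_parametrization
  have hK : IsOrderable K := ⟨inferInstance, h1⟩
  have hb : Function.Bijective (T.restrictPreimage g) := by
    constructor
    · rintro ⟨x, hx⟩ ⟨y, hy⟩ hxy
      rcases hinj x y (congrArg Subtype.val hxy) with rfl | h | h
      · rfl
      · exact absurd ((hend x y h.1 h.2).1 ▸ hx) hp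
      · exact absurd ((hend y x h.1 h.2).1 ▸ hy) hp
    · rintro ⟨y, hy⟩
      obtain ⟨x, rfl⟩ := hTL hy
      exact ⟨⟨x, hy⟩, rfl⟩
  let e := (Equiv.ofBijective _ hb).toHomeomorphOfContinuousClosed
    hg.restrictPreimage (hg.isClosedMap.restrictPreimage T)
  exact (hK.isSuborderable.of_isEmbedding IsEmbedding.subtypeVal).of_isEmbedding
    e.symm.isEmbedding

end Loops

/-! ### Topology of the endpoint quotient -/

section EndpointQuotient

open Set

variable {K : Type u} [LinearOrder K]

theorem EndpointQuotient.mk_eq_iff {x y : K} :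
    (Quot.mk _ x : EndpointQuotient K) = Quot.mk _ y ↔
      x = y ∨ (IsBot x ∧ IsTop y) ∨ (IsBot y ∧ IsTop x) := by
  constructor
  · intro h
    -- The equivalence relation generated by the identification; it descends to the quotient in its
    -- first argument.
    let s : K → K → Prop := fun x y => x = y ∨ (IsBot x ∧ IsTop y) ∨ (IsBot y ∧ IsTop x)
    have hs : ∀ a b : K, IsBot a ∧ IsTop b → s a = s b := by
      rintro a b ⟨ha, hb⟩
      funext z
      have hba : ∀ {a b : K}, IsBot a → IsBot b → a = b := fun h h' => le_antisymm (h _) (h' _)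
      have hta : ∀ {a b : K}, IsTop a → IsTop b → a = b := fun h h' => le_antisymm (h' _) (h _)
      refine propext ⟨?_, ?_⟩
      · rintro (rfl | ⟨-, hz⟩ | ⟨hz, -⟩)
        · exact Or.inr (Or.inr ⟨ha, hb⟩)
        · exact Or.inl (hta hb hz)
        · exact Or.inr (Or.inr ⟨hz, hb⟩)
      · rintro (rfl | ⟨-, hz⟩ | ⟨hz, -⟩)
        · exact Or.inr (Or.inl ⟨ha, hb⟩)
        · exact Or.inr (Or.inl ⟨ha, hz⟩)
        · exact Or.inl (hba ha hz)
    have : s x y = s y y := congrFun (congrArg (Quot.lift s hs) h) y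
    exact this.mpr (Or.inl rfl)
  · rintro (rfl | h | h)
    · rfl
    · exact Quot.sound h
    · exact (Quot.sound (r := fun x y : K => IsBot x ∧ IsTop y) h).symm

variable [TopologicalSpace K] [OrderTopology K]

/-- Saturating a closed set adds at most the two endpoints. -/
theorem EndpointQuotient.isClosedMap_mk :
    IsClosedMap (Quot.mk _ : K → EndpointQuotient K) := by
  intro F hF
  rw [← isQuotientMap_quot_mk.isClosed_preimage]
  have hsub : ∀ p : K → Prop, (∀ a b, p a → p b → a = b) → IsClosed {x | p x} := fun p hp =>
    (show {x | p x}.Subsingleton from fun a ha b hb => hp a b ha hb).finite.isClosed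
  have : Quot.mk _ ⁻¹' ((Quot.mk _ : K → EndpointQuotient K) '' F) =
      F ∪ {x | IsTop x ∧ ∃ y ∈ F, IsBot y} ∪ {x | IsBot x ∧ ∃ y ∈ F, IsTop y} := by
    ext x
    simp only [mem_preimage, mem_image, EndpointQuotient.mk_eq_iff, mem_union, mem_ofPred_eq]
    constructor
    · rintro ⟨y, hy, rfl | h | h⟩
      · exact Or.inl (Or.inl hy)
      · exact Or.inl (Or.inr ⟨h.2, y, hy, h.1⟩)
      · exact Or.inr ⟨h.1, y, hy, h.2⟩
    · rintro ((h | ⟨h, y, hy, h'⟩) | ⟨h, y, hy, h'⟩)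
      · exact ⟨x, h, Or.inl rfl⟩
      · exact ⟨y, hy, Or.inr (Or.inl ⟨h', h⟩)⟩
      · exact ⟨y, hy, Or.inr (Or.inr ⟨h, h'⟩)⟩
  rw [this]
  exact (hF.union (hsub _ fun a b ha hb => le_antisymm (hb.1 _) (ha.1 _))).union
    (hsub _ fun a b ha hb => le_antisymm (ha.1 _) (hb.1 _))

variable [CompactSpace K]

instance EndpointQuotient.t2Space : T2Space (EndpointQuotient K) := by
  refine ⟨fun a b hab => ?_⟩
  have hcl := EndpointQuotient.isClosedMap_mk (K := K)
  have hcont : Continuous (Quot.mk _ : K → EndpointQuotient K) := continuous_quot_mk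
  have hpt : ∀ c : EndpointQuotient K, IsClosed ((Quot.mk _ : K → EndpointQuotient K) ⁻¹' {c}) := by
    rintro ⟨x⟩
    refine IsClosed.preimage hcont ?_
    rw [← image_singleton]
    exact hcl _ isClosed_singleton
  -- Separate the closed fibres in the normal space `K`; closedness of the quotient map pushes the
  -- separation down.
  obtain ⟨U, V, hU, hV, haU, hbV, hUV⟩ := normal_separation (hpt a) (hpt b)
    (Disjoint.preimage _ (disjoint_singleton.2 hab))
  refine ⟨_, _, (hcl _ hU.isClosed_compl).isOpen_compl, (hcl _ hV.isClosed_compl).isOpen_compl,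
    ?_, ?_, ?_⟩
  · rintro ⟨x, hx, rfl⟩
    exact hx (haU rfl)
  · rintro ⟨x, hx, rfl⟩
    exact hx (hbV rfl)
  · rw [disjoint_left]
    rintro ⟨x⟩ hx hx'
    have h1 : x ∈ U := by
      by_contra h
      exact hx ⟨x, h, rfl⟩
    have h2 : x ∈ V := by
      by_contra h
      exact hx' ⟨x, h, rfl⟩
    exact disjoint_left.1 hUV h1 h2

theorem IsArc.isOrderable {Y : Type u} [TopologicalSpace Y] [CompactSpace Y] [T2Space Y]
    {A : Set Y} {a b : Y} (h : IsArc A a b) : IsOrderable A := by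
  obtain ⟨_, hA, -⟩ := h
  exact hA.isOrderable hA.isClosed.isCompact

theorem EndpointQuotient.isLocallyOrdered [ConnectedSpace K] [Nontrivial K] :
    IsLocallyOrdered (EndpointQuotient K) := by
  have hcl := EndpointQuotient.isClosedMap_mk (K := K)
  have hcont : Continuous (Quot.mk _ : K → EndpointQuotient K) := continuous_quot_mk
  have hO := orderedOn_univ (X := K)
  have hc : IsPreconnected (univ : Set K) := isPreconnected_univ
  obtain ⟨b, -, hb⟩ := hO.exists_isLeast Subset.rfl isClosed_univ univ_nonempty
  obtain ⟨t, -, ht⟩ := hO.exists_isGreatest Subset.rfl isClosed_univ univ_nonempty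
  have hb : IsBot b := fun x => hb (mem_univ x)
  have ht : IsTop t := fun x => ht (mem_univ x)
  have hbt : b < t := by
    obtain ⟨x, hx⟩ := exists_ne b
    exact (lt_of_le_of_ne (hb x) hx.symm).trans_le (ht x)
  have hbot : ∀ {x}, IsBot x → x = b := fun h => le_antisymm (h b) (hb _)
  have htop : ∀ {x}, IsTop x → x = t := fun h => le_antisymm (ht _) (h t)
  have mk_eq : ∀ {x y : K}, (Quot.mk _ x : EndpointQuotient K) = Quot.mk _ y →
      x = y ∨ (x = b ∧ y = t) ∨ (y = b ∧ x = t) := fun h =>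
    (EndpointQuotient.mk_eq_iff.1 h).imp id
      (Or.imp (fun h => ⟨hbot h.1, htop h.2⟩) fun h => ⟨hbot h.1, htop h.2⟩)
  have hsound : (Quot.mk _ b : EndpointQuotient K) = Quot.mk _ t := Quot.sound ⟨hb, ht⟩
  have dense : ∀ {x y : K}, x < y → ∃ z, x < z ∧ z < y := fun h => by
    obtain ⟨z, -, hz⟩ := hO.exists_between hc (mem_univ _) (mem_univ _) h
    exact ⟨z, hz⟩
  -- An interval that misses one endpoint of `K` maps injectively to the quotient.
  have arc : ∀ {x y : K}, x ≤ y → (b < x ∨ y < t) →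
      IsArc ((Quot.mk _ : K → EndpointQuotient K) '' Icc x y) (Quot.mk _ x) (Quot.mk _ y) := by
    intro x y hxy h
    have := hO.isArc_Icc hc (mem_univ x) (mem_univ y) hxy
    rw [univ_inter] at this
    refine this.image hcont.continuousOn fun z hz w hw hzw => ?_
    rcases mk_eq hzw with h' | ⟨rfl, rfl⟩ | ⟨rfl, rfl⟩
    · exact h'
    · rcases h with h | h
      · exact absurd (h.trans_le hz.1) (lt_irrefl _)
      · exact absurd (hw.2.trans_lt h) (lt_irrefl _)
    · rcases h with h | h
      · exact absurd (h.trans_le hw.1) (lt_irrefl _)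
      · exact absurd (hz.2.trans_lt h) (lt_irrefl _)
  -- Around the identified point, the end interval from `r` to `t` is followed by the initial one
  -- from `b` to `s`.
  have base : ∃ U ∈ 𝓝 (Quot.mk _ b : EndpointQuotient K), IsOrderable U := by
    obtain ⟨s, hbs, hst⟩ := dense hbt
    obtain ⟨r, hsr, hrt⟩ := dense hst
    have h1 := arc hrt.le (Or.inl (hbs.trans hsr))
    have h2 := arc hbs.le (Or.inr hst)
    rw [← hsound] at h1
    refine ⟨_, ?_, (h1.glue h2 ?_).isOrderable⟩
    · refine Filter.mem_of_superset ((hcl (Icc s r) isClosed_Icc).isOpen_compl.mem_nhds ?_) ?_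
      · rintro ⟨x, hx, h⟩
        rcases mk_eq h with rfl | ⟨rfl, h⟩ | ⟨h, rfl⟩
        · exact absurd (hbs.trans_le hx.1) (lt_irrefl _)
        · exact absurd h hbt.ne
        · exact absurd (hx.2.trans_lt hrt) (lt_irrefl _)
      · rintro ⟨x⟩ hx
        rcases le_total x s with h | h
        · exact Or.inr ⟨x, ⟨hb x, h⟩, rfl⟩
        rcases le_total x r with h' | h'
        · exact absurd ⟨x, ⟨h, h'⟩, rfl⟩ hx
        · exact Or.inl ⟨x, ⟨h', ht x⟩, rfl⟩
    · rintro _ ⟨⟨x, hx, rfl⟩, y, hy, h⟩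
      rcases mk_eq h with rfl | ⟨rfl, h⟩ | ⟨rfl, rfl⟩
      · exact absurd (hy.2.trans_lt (hsr.trans_le hx.1)) (lt_irrefl _)
      · rw [h]
        exact hsound.symm
      · exact absurd (hy.2.trans_lt hst) (lt_irrefl _)
  rintro ⟨x⟩
  by_cases hxb : x = b
  · subst hxb
    exact base
  by_cases hxt : x = t
  · subst hxt
    change ∃ U ∈ 𝓝 (Quot.mk _ x : EndpointQuotient K), IsOrderable U
    rw [← hsound]
    exact base
  obtain ⟨s, hbs, hsx⟩ := dense (lt_of_le_of_ne (hb x) (Ne.symm hxb))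
  obtain ⟨r, hxr, hrt⟩ := dense (lt_of_le_of_ne (ht x) hxt)
  refine ⟨_, ?_, (arc (hsx.trans hxr).le (Or.inl hbs)).isOrderable⟩
  refine Filter.mem_of_superset
    ((hcl (Iic s ∪ Ici r) (isClosed_Iic.union isClosed_Ici)).isOpen_compl.mem_nhds ?_) ?_
  · rintro ⟨y, hy, h⟩
    rcases mk_eq h with rfl | ⟨-, h⟩ | ⟨h, -⟩
    · rcases hy with hy | hy
      · exact absurd (hsx.trans_le hy) (lt_irrefl _)
      · exact absurd (hxr.trans_le hy) (lt_irrefl _)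
    · exact hxt h
    · exact hxb h
  · rintro ⟨y⟩ hy
    rcases le_total y s with h | h
    · exact absurd ⟨y, Or.inl h, rfl⟩ hy
    rcases le_total y r with h' | h'
    · exact ⟨y, ⟨h, h'⟩, rfl⟩
    · exact absurd ⟨y, Or.inr h', rfl⟩ hy

end EndpointQuotient

/-! ### Compactifications and decompositions -/

section Compactification

open Set

variable {X Y : Type u} [TopologicalSpace X] [TopologicalSpace Y]

theorem IsLoopOrdered.of_homeomorph (h : IsLoopOrdered Y) (e : X ≃ₜ Y) : IsLoopOrdered X := by
  obtain ⟨K, _, _, h1, h2, h3, h4, ⟨e'⟩⟩ := h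
  exact ⟨K, inferInstance, inferInstance, h1, h2, h3, h4, ⟨e.trans e'⟩⟩

theorem IsLoopOrdered.compactSpace (h : IsLoopOrdered X) : CompactSpace X := by
  obtain ⟨K, _, _, _, _, _, _, ⟨e⟩⟩ := h
  exact e.symm.compactSpace

theorem IsLoopOrdered.t2Space (h : IsLoopOrdered X) : T2Space X := by
  obtain ⟨K, _, _, _, _, _, _, ⟨e⟩⟩ := h
  exact e.symm.t2Space

theorem IsLoopOrdered.isLocallyOrdered (h : IsLoopOrdered X) : IsLocallyOrdered X := by
  obtain ⟨K, _, _, _, _, _, _, ⟨e⟩⟩ := h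
  exact IsLocallyOrdered.of_isOpenEmbedding fun x => ⟨_, inferInstance, e.symm,
    EndpointQuotient.isLocallyOrdered, e.symm.isOpenEmbedding, e x, e.symm_apply_apply x⟩

theorem IsSuborderable.exists_isDenseEmbedding (h : IsSuborderable X) :
    ∃ (K : Type u) (_ : TopologicalSpace K),
      CompactSpace K ∧ T2Space K ∧ IsOrderable K ∧ ∃ f : X → K, IsDenseEmbedding f := by
  obtain ⟨K, _, _, _, _, f, hf⟩ := h.exists_compactSpace
  have hO : OrderedOn (closure (range f)) := orderedOn_univ.mono (subset_univ _) isClosed_closure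
  have hmem : ∀ x, f x ∈ closure (range f) := fun x => subset_closure (mem_range_self x)
  refine ⟨closure (range f), inferInstance, isCompact_iff_compactSpace.1 isClosed_closure.isCompact,
    inferInstance, hO.isOrderable isClosed_closure.isCompact,
    codRestrict f _ hmem, ⟨⟨(hf.codRestrict _ hmem).isInducing, ?_⟩, (hf.codRestrict _ hmem).injective⟩⟩
  rintro ⟨y, hy⟩
  rw [closure_subtype, ← range_comp]
  exact hy

theorem HasLocallyOrderedCompactification.of_homeomorph_sum {S : Type u} [TopologicalSpace S]
    {ι : Type} [Finite ι] {L : ι → Type u} [∀ i, TopologicalSpace (L i)] (hS : IsSuborderable S)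
    (hL : ∀ i, IsLoopOrdered (L i)) (e : X ≃ₜ S ⊕ (Σ i, L i)) :
    HasLocallyOrderedCompactification X := by
  obtain ⟨K, _, _, _, hK, f, hf⟩ := hS.exists_isDenseEmbedding
  have := fun i => (hL i).compactSpace
  have := fun i => (hL i).t2Space
  refine ⟨K ⊕ (Σ i, L i), inferInstance, inferInstance, inferInstance,
    IsLocallyOrdered.of_isOpenEmbedding ?_, Sum.map f id ∘ e, ⟨⟨?_, ?_⟩, ?_⟩⟩
  · rintro (x | ⟨i, x⟩)
    · exact ⟨K, inferInstance, Sum.inl, hK.isLocallyOrdered, .inl, x, rfl⟩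
    · exact ⟨L i, inferInstance, fun x => Sum.inr ⟨i, x⟩, (hL i).isLocallyOrdered,
        IsOpenEmbedding.inr.comp .sigmaMk, x, rfl⟩
  · exact ((isEmbedding_sumMap hf.isEmbedding IsEmbedding.id).comp e.isEmbedding).isInducing
  · refine DenseRange.comp ?_ e.surjective.denseRange (continuous_sumMap.2
      ⟨hf.isEmbedding.continuous, continuous_id⟩)
    rintro (x | x)
    · have h := image_closure_subset_closure_image (s := range f) (f := (Sum.inl : K → K ⊕ (Σ i, L i)))
        continuous_inl ⟨x, hf.dense x, rfl⟩
      refine closure_mono ?_ h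
      rintro _ ⟨_, ⟨s, rfl⟩, rfl⟩
      exact ⟨Sum.inl s, rfl⟩
    · exact subset_closure ⟨Sum.inr x, rfl⟩
  · exact ((isEmbedding_sumMap hf.isEmbedding IsEmbedding.id).comp e.isEmbedding).injective

/-- A subset of a space is a disjoint union of finitely many loop-ordered clopen sets and a
suborderable set. -/
def IsSuborderableSumLoops (W : Set X) : Prop :=
  ∃ 𝓖 : Set (Set X), 𝓖.Finite ∧ (∀ G ∈ 𝓖, IsClopen G ∧ IsLoopOrdered G ∧ G ⊆ W) ∧
    𝓖.PairwiseDisjoint id ∧ IsSuborderable (W \ ⋃₀ 𝓖 : Set X)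

theorem IsSuborderable.isSuborderableSumLoops {W : Set X} (h : IsSuborderable W) :
    IsSuborderableSumLoops W :=
  ⟨∅, finite_empty, by simp, pairwiseDisjoint_empty, by rwa [sUnion_empty, sdiff_empty]⟩

theorem isSuborderable_of_isEmpty [IsEmpty X] : IsSuborderable X :=
  let L : LinearOrder X :=
    LinearOrder.lift' (fun x => (isEmptyElim x : ℕ)) (Function.injective_of_subsingleton _)
  IsOrderable.isSuborderable ⟨L, ⟨Subsingleton.elim _ _⟩⟩

theorem IsLoopOrdered.isSuborderableSumLoops {W : Set X} (hW : IsClopen W) (h : IsLoopOrdered W) :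
    IsSuborderableSumLoops W := by
  refine ⟨{W}, finite_singleton W, ?_, pairwiseDisjoint_singleton W id, ?_⟩
  · rintro _ rfl
    exact ⟨hW, h, Subset.rfl⟩
  · rw [sUnion_singleton, sdiff_self]
    have : IsEmpty ((⊥ : Set X) : Type u) := isEmpty_coe_sort.2 rfl
    exact isSuborderable_of_isEmpty

/-- The loops are collected, and the suborderable remainders merge because the clopen set `V`
separates them. -/
theorem IsSuborderableSumLoops.union {V W : Set X} (hV : IsSuborderableSumLoops V)
    (hW : IsSuborderableSumLoops W) (hVc : IsClopen V) (hVW : Disjoint V W) :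
    IsSuborderableSumLoops (V ∪ W) := by
  obtain ⟨𝓖, h1, h2, h3, h4⟩ := hV
  obtain ⟨𝓗, h1', h2', h3', h4'⟩ := hW
  have hG : ⋃₀ 𝓖 ⊆ V := sUnion_subset fun G hG => (h2 G hG).2.2
  have hH : ⋃₀ 𝓗 ⊆ W := sUnion_subset fun G hG => (h2' G hG).2.2
  refine ⟨𝓖 ∪ 𝓗, h1.union h1', ?_, h3.union h3' ?_, ?_⟩
  · rintro G (hG | hG)
    · exact ⟨(h2 G hG).1, (h2 G hG).2.1, (h2 G hG).2.2.trans subset_union_left⟩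
    · exact ⟨(h2' G hG).1, (h2' G hG).2.1, (h2' G hG).2.2.trans subset_union_right⟩
  · exact fun G hG H hH _ => hVW.mono (h2 G hG).2.2 (h2' H hH).2.2
  · have : (V ∪ W) \ ⋃₀ (𝓖 ∪ 𝓗) = (V \ ⋃₀ 𝓖) ∪ (W \ ⋃₀ 𝓗) := by
      rw [sUnion_union]
      ext x
      have h1 := @hG x
      have h2 := @hH x
      have h3 : x ∈ V → x ∉ W := fun h => disjoint_left.1 hVW h
      simp only [mem_sdiff, mem_union]
      tauto
    rw [this]
    exact h4.union hVc h4' sdiff_subset (hVW.symm.mono_left sdiff_subset)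

theorem isSuborderableSumLoops_preimage [CompactSpace Y] [T2Space Y] {f : X → Y}
    (hf : IsEmbedding f) {D E : Set Y} (hD : IsClopen D) (hDE : D ⊆ E)
    (hE : (∃ _ : LinearOrder Y, OrderedOn E) ∨ ∃ p, IsLoop E p) :
    IsSuborderableSumLoops (f ⁻¹' D) := by
  have hres : IsEmbedding (D.restrictPreimage f) := hf.restrictPreimage D
  rcases hE with ⟨L, hE⟩ | ⟨p, hE⟩
  · exact ((hE.isSuborderable hDE).of_isEmbedding hres).isSuborderableSumLoops
  -- Either `X` fills the whole loop, or some point of the loop is missed; rotating the base there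
  -- cuts the loop open.
  · by_cases hDf : E ⊆ D ∧ E ⊆ range f
    · obtain rfl := hDE.antisymm hDf.1
      have hs : Function.Surjective (D.restrictPreimage f) := by
        rintro ⟨y, hy⟩
        obtain ⟨x, rfl⟩ := hDf.2 hy
        exact ⟨⟨x, hy⟩, rfl⟩
      exact (hE.isLoopOrdered.of_homeomorph (hres.toHomeomorphOfSurjective hs)).isSuborderableSumLoops
        (hD.preimage hf.continuous)
    · obtain ⟨q, hq, hqT⟩ : ∃ q ∈ E, q ∉ D ∩ range f := by
        by_contra! h
        exact hDf ⟨fun q hq => (h q hq).1, fun q hq => (h q hq).2⟩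
      have hsub := (hE.rotate hq).isSuborderable (inter_subset_left.trans hDE) hqT
      refine (hsub.of_isEmbedding ((hf.comp IsEmbedding.subtypeVal).codRestrict (D ∩ range f)
        fun x : f ⁻¹' D => ⟨x.2, mem_range_self x.1⟩)).isSuborderableSumLoops

theorem IsLocallyOrdered.isSuborderableSumLoops_univ [CompactSpace Y] [T2Space Y]
    (hY : IsLocallyOrdered Y) {f : X → Y} (hf : IsEmbedding f) :
    IsSuborderableSumLoops (univ : Set X) := by
  classical
  choose E hEc hxE hE using hY.exists_isClopen
  obtain ⟨t, ht⟩ := isCompact_univ.elim_nhds_subcover E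
    fun x _ => (hEc x).isOpen.mem_nhds (hxE x)
  have key : ∀ s : Finset Y, IsSuborderableSumLoops (f ⁻¹' ⋃ x ∈ s, E x) := by
    intro s
    induction s using Finset.induction_on with
    | empty =>
      have : IsEmpty (f ⁻¹' (⋃ x ∈ (∅ : Finset Y), E x) : Set X) := by simp
      exact isSuborderable_of_isEmpty.isSuborderableSumLoops
    | insert a s _ ih =>
      have hs : IsClopen (⋃ x ∈ s, E x) := isClopen_biUnion_finset fun x _ => hEc x
      -- Pieces are made disjoint by subtracting the earlier ones, so only a clopen part of `E a`
      -- may remain.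
      have := isSuborderableSumLoops_preimage hf ((hEc a).diff hs) sdiff_subset (hE a)
      rw [Finset.set_biUnion_insert, union_comm, ← union_sdiff_self, preimage_union]
      exact ih.union this (hs.preimage hf.continuous) (disjoint_sdiff_right.preimage f)
  have := key t
  rwa [univ_subset_iff.1 ht.2, preimage_univ] at this

theorem IsSuborderableSumLoops.exists_homeomorph
    (h : IsSuborderableSumLoops (univ : Set X)) :
    ∃ (S : Type u) (_ : TopologicalSpace S) (n : ℕ) (L : Fin n → Type u)
      (_ : ∀ i, TopologicalSpace (L i)),
      IsSuborderable S ∧ (∀ i, IsLoopOrdered (L i)) ∧ Nonempty (X ≃ₜ S ⊕ (Σ i, L i)) := by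
  obtain ⟨𝓖, hfin, hG, hdis, hS⟩ := h
  have := hfin.to_subtype
  obtain ⟨n, ⟨e⟩⟩ := Finite.exists_equiv_fin 𝓖
  let L : Fin n → Set X := fun i => (e.symm i).1
  have hL : ∀ i, L i ∈ 𝓖 := fun i => (e.symm i).2
  let S : Set X := univ \ ⋃₀ 𝓖
  have hSo : IsOpen S := by
    have : IsClosed (⋃₀ 𝓖) := by
      rw [sUnion_eq_biUnion]
      exact hfin.isClosed_biUnion fun G h => (hG G h).1.isClosed
    exact isOpen_univ.sdiff this
  let φ : S ⊕ (Σ i, L i) → X := Sum.elim Subtype.val fun x => x.2.1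
  have hφ : Continuous φ := continuous_sumElim.2
    ⟨continuous_subtype_val, continuous_sigma fun i => continuous_subtype_val⟩
  have hφo : IsOpenMap φ := isOpenMap_sumElim.2 ⟨hSo.isOpenMap_subtype_val,
    isOpenMap_sigma.2 fun i => (hG _ (hL i)).1.isOpen.isOpenMap_subtype_val⟩
  have hφb : Function.Bijective φ := by
    constructor
    · rintro (⟨x, hx⟩ | ⟨i, x, hx⟩) (⟨y, hy⟩ | ⟨j, y, hy⟩) hxy
      · obtain rfl : x = y := hxy
        rfl
      · obtain rfl : x = y := hxy
        exact absurd ⟨L j, hL j, hy⟩ hx.2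
      · obtain rfl : x = y := hxy
        exact absurd ⟨L i, hL i, hx⟩ hy.2
      · obtain rfl : x = y := hxy
        obtain rfl : i = j := e.symm.injective (Subtype.ext
          (hdis.elim (hL i) (hL j) (not_disjoint_iff.2 ⟨x, hx, hy⟩)))
        rfl
    · intro x
      by_cases hx : x ∈ ⋃₀ 𝓖
      · obtain ⟨G, hG, hxG⟩ := hx
        exact ⟨Sum.inr ⟨e ⟨G, hG⟩, x, by simpa [L] using hxG⟩, rfl⟩
      · exact ⟨Sum.inl ⟨x, mem_univ x, hx⟩, rfl⟩
  exact ⟨S, inferInstance, n, fun i => L i, inferInstance, hS, fun i => (hG _ (hL i)).2.1,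
    ⟨((Equiv.ofBijective φ hφb).toHomeomorphOfContinuousOpen hφ hφo).symm⟩⟩

end Compactification

theorem mainTheorem6 (X : Type u) [TopologicalSpace X] :
    HasLocallyOrderedCompactification X ↔
      ∃ (S : Type u) (_ : TopologicalSpace S) (n : ℕ) (L : Fin n → Type u)
        (_ : ∀ i, TopologicalSpace (L i)),
        IsSuborderable S ∧ (∀ i, IsLoopOrdered (L i)) ∧ Nonempty (X ≃ₜ S ⊕ (Σ i, L i)) := by
  constructor
  · rintro ⟨Y, _, _, _, hY, f, hf⟩
    exact (hY.isSuborderableSumLoops_univ hf.isEmbedding).exists_homeomorph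
  · rintro ⟨S, _, n, L, _, hS, hL, ⟨e⟩⟩
    exact .of_homeomorph_sum hS hL e
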